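/- Let $\mathfrak h$ be a finite-dimensional real vector space and $I=\{1,\dots,n\}$. Let $(H_i,L_i)_{i\in I}$ be a linear Coxeter system: $H_i=\mathbb R_{\ge 0}h_i\subseteq\mathfrak h$ and $L_i=\mathbb R_{\ge 0}\alpha_i\subseteq\mathfrak h^*$ are rays with generators normalized by $\alpha_i(h_i)=2$; the cone $\overline C=\{\lambda\in\mathfrak h^*\mid \lambda(h_i)\ge 0\ \forall i\in I\}$ spans $\mathfrak h^*$, and its pairwise different faces of codimension $1$ are $\{\lambda\in\overline C\mid\lambda(h_i)=0\}$, $i\in I$; and, with $C=\{\lambda\mid\lambda(h_i)>0\ \forall i\in I\}$ and $\mathcal W\subseteq GL(\mathfrak h^*)$ the group generated by the reflections $\sigma_i(\lambda)=\lambda-\lambda(h_i)\alpha_i$, one has $\sigma C\cap C=\emptyset$ for all $\sigma\in\mathcal W\setminus\{1\}$. For $J\subseteq I$ put $\mathcal W_J=\langle\sigma_i\mid i\in J\rangle$ and $$F_J=\{\lambda\in\mathfrak h^*\mid \lambda(h_i)=0\ (i\in J),\ \lambda(h_i)>0\ (i\in I\setminus J)\},$$ $$\overline F_J=\{\lambda\in\mathfrak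 h^*\mid \lambda(h_i)=0\ (i\in J),\ \lambda(h_i)\ge 0\ (i\in I\setminus J)\}.$$ Let $A=(a_{ij})=(\alpha_j(h_i))_{i,j\in I}$. The connected components of $J\subseteq I$ are those of the graph on $J$ in which $i\ne j$ are joined if $a_{ij}\neq 0$ (equivalently $a_{ji}\ne 0$). A component $K$ is of finite type if the matrix $A_K=(a_{ij})_{i,j\in K}$ satisfies: $\det A_K\ne0$; there is $u>0$ with $A_Ku>0$; and $A_Kv\ge0$ implies $v>0$ or $v=0$ (componentwise inequalities). Let $J^0$ be the union of the components of finite type of $J$. If $J^0=J$, let $\mathrm{mid}_J(\lambda)=\frac1{|\mathcal W_J|}\sum_{\sigma\in\mathcal W_J}\sigma\lambda$. Let $Y$ be a $\mathcal W$-invariant convex cone containing $0$ that is contained in the Tits cone $X=\bigcup_{\sigma\in\mathcal W}\sigma\overline C$. Write $\mathrm{ri}$ for the relative interior, and let $\Upsilon$ be the set of nonempty faces $R$ of $Y$ with $\mathrm{ri}(R)\cap\overline C\ne\emptyset$. For $R\in\Upsilon$ put $\upsilon_*(R)=\{i\in I\mid \sigma_i\lambda=\lambda\ \forall\lambda\in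 R\}$ and $\upsilon^*(R)=\{i\in I\mid\sigma_iR=R\}\setminus\upsilon_*(R)$. **Theorem.** Let $R\in\Upsilon$. Then $$\mathrm{ri}(R)\cap\overline C=\bigcup_{J_f\subseteq\upsilon^*(R),\ (J_f)^0=J_f}\mathrm{ri}(R)\cap F_{\upsilon_*(R)\cup J_f},$$ the union is disjoint, and each of the sets $\mathrm{ri}(R)\cap F_{\upsilon_*(R)\cup J_f}$ in it is nonempty. Moreover, for every $J_f\subseteq\upsilon^*(R)$ with $(J_f)^0=J_f$ the group $\mathcal W_{J_f}$ is finite, and $$\mathrm{mid}_{J_f}\big(\mathrm{ri}(R\cap\overline C)\big)=\mathrm{mid}_{J_f}\big(\mathrm{ri}(R\cap\overline F_{\upsilon_*(R)})\big)=\mathrm{ri}(R)\cap F_{\upsilon_*(R)\cup J_f}.$$ -/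

import Mathlib

open Module

noncomputable section

universe u

/-- The relative interior of a subset of a real vector space: the interior of the set inside its
affine span, with respect to the canonical vector space topology (for a finite-dimensional space,
the topology given by any norm). -/
def relInt {V : Type u} [AddCommGroup V] [Module ℝ V] (s : Set V) : Set V :=
  letI : TopologicalSpace V := moduleTopology ℝ V
  intrinsicInterior ℝ s

/-- A square real matrix is of finite type: `det M ≠ 0`, there is `u > 0` with `M u > 0`, and
`M v ≥ 0` implies `v > 0` or `v = 0`. It is used for the matrices of connected sets of indices. -/
def IsFiniteTypeMatrix {ι : Type} [Fintype ι] [DecidableEq ι] (M : Matrix ι ι ℝ) : Prop :=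
  M.det ≠ 0 ∧
    (∃ u : ι → ℝ, (∀ i, 0 < u i) ∧ ∀ i, 0 < M.mulVec u i) ∧
    ∀ v : ι → ℝ, (∀ i, 0 ≤ M.mulVec v i) → (∀ i, 0 < v i) ∨ v = 0

/-- Vectors `h i` of `𝔥` and `α i` of the dual space with `α i (h i) = 2`. They encode the rays
`H i = ℝ≥0 • h i` and `L i = ℝ≥0 • α i`, for which then `L i \ {0} ⊆ H i ^ {>0}`; every pair of
rays with the latter property has such generators. -/
structure ReflectionDatum (𝔥 : Type u) [AddCommGroup 𝔥] [Module ℝ 𝔥] (n : ℕ) where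
  h : Fin n → 𝔥
  α : Fin n → Dual ℝ 𝔥
  pairing_self : ∀ i, α i (h i) = 2

namespace ReflectionDatum

variable {𝔥 : Type u} [AddCommGroup 𝔥] [Module ℝ 𝔥] {n : ℕ} (S : ReflectionDatum 𝔥 n)

/-- The matrix `A = (α_j(h_i))_{i,j}`. -/
def cartan : Matrix (Fin n) (Fin n) ℝ := Matrix.of fun i j => S.α j (S.h i)

/-- The simple reflection `l ↦ l - l (h i) • α i` of the dual space. -/
def refl (i : Fin n) : Dual ℝ 𝔥 ≃ₗ[ℝ] Dual ℝ 𝔥 :=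
  Module.reflection (x := S.α i) (f := Dual.eval ℝ 𝔥 (S.h i))
    ((Dual.eval_apply ℝ 𝔥 (S.h i) (S.α i)).trans (S.pairing_self i))

theorem refl_apply (i : Fin n) (l : Dual ℝ 𝔥) : S.refl i l = l - l (S.h i) • S.α i := by
  rw [refl, Module.reflection_apply, Dual.eval_apply]

/-- The standard parabolic subgroup `W_J`, generated by the `σ_i`, `i ∈ J`. -/
def parabolic (J : Set (Fin n)) : Subgroup (Dual ℝ 𝔥 ≃ₗ[ℝ] Dual ℝ 𝔥) :=
  Subgroup.closure (S.refl '' J)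

/-- The group `W` generated by all simple reflections. -/
def weyl : Subgroup (Dual ℝ 𝔥 ≃ₗ[ℝ] Dual ℝ 𝔥) := Subgroup.closure (Set.range S.refl)

/-- The closed fundamental chamber. -/
def closedChamber : PointedCone ℝ (Dual ℝ 𝔥) where
  carrier := {l | ∀ i, 0 ≤ l (S.h i)}
  add_mem' := fun ha hb i => add_nonneg (ha i) (hb i)
  zero_mem' := fun _ => le_rfl
  smul_mem' := fun c _ hx i => mul_nonneg c.2 (hx i)

/-- The open fundamental chamber. -/
def openChamber : Set (Dual ℝ 𝔥) := {l | ∀ i, 0 < l (S.h i)}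

/-- The set `closedChamber ∩ H_i ^ {=0}`. -/
def wall (i : Fin n) : Set (Dual ℝ 𝔥) := {l | l ∈ S.closedChamber ∧ l (S.h i) = 0}

/-- The rays generated by the `h i` and `α i` form a linear Coxeter system: the closed chamber
spans the dual space, its one-codimensional faces are the pairwise different sets `wall i`, and
the translates of the open chamber by the nontrivial elements of `W` do not meet it. -/
structure IsLinearCoxeterSystem : Prop where
  span_chamber : Submodule.span ℝ (S.closedChamber : Set (Dual ℝ 𝔥)) = ⊤
  facet_iff : ∀ F : PointedCone ℝ (Dual ℝ 𝔥),
    (F.IsFaceOf S.closedChamber ∧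
      finrank ℝ (Submodule.span ℝ (F : Set (Dual ℝ 𝔥))) + 1 = finrank ℝ (Dual ℝ 𝔥)) ↔
    ∃ i, (F : Set (Dual ℝ 𝔥)) = S.wall i
  wall_injective : Function.Injective S.wall
  disjoint_translate : ∀ σ ∈ S.weyl, σ ≠ 1 → (σ '' S.openChamber) ∩ S.openChamber = ∅

/-- The Tits cone. -/
def titsCone : Set (Dual ℝ 𝔥) :=
  ⋃ σ ∈ S.weyl, σ '' (S.closedChamber : Set (Dual ℝ 𝔥))

/-- The closed facet of type `J`. -/
def closedFacet (J : Set (Fin n)) : Set (Dual ℝ 𝔥) :=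
  {l | (∀ i ∈ J, l (S.h i) = 0) ∧ ∀ i ∉ J, 0 ≤ l (S.h i)}

/-- The open facet of type `J`. -/
def openFacet (J : Set (Fin n)) : Set (Dual ℝ 𝔥) :=
  {l | (∀ i ∈ J, l (S.h i) = 0) ∧ ∀ i ∉ J, 0 < l (S.h i)}

/-- Indices `i ≠ j` are joined by an edge if `a_ij ≠ 0` or `a_ji ≠ 0` (for a linear Coxeter system
the two conditions are equivalent). -/
def diagram : SimpleGraph (Fin n) := SimpleGraph.fromRel fun i j => S.cartan i j ≠ 0

/-- `K` is a connected component of `J` in the diagram. -/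
def IsComponent (J K : Set (Fin n)) : Prop :=
  ∃ c : (S.diagram.induce J).ConnectedComponent, K = Subtype.val '' c.supp

open Classical in
/-- The submatrix of `A` belonging to `K` is of finite type. -/
def IsFiniteType (K : Set (Fin n)) : Prop :=
  IsFiniteTypeMatrix (ι := K) (S.cartan.submatrix Subtype.val Subtype.val)

/-- The union `J^0` of the components of finite type of `J`. -/
def finitePart (J : Set (Fin n)) : Set (Fin n) :=
  ⋃₀ {K | S.IsComponent J K ∧ S.IsFiniteType K}

/-- The projector `l ↦ |W_J|⁻¹ ∑_{σ ∈ W_J} σ l`, for `W_J` finite. -/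
def mid (J : Set (Fin n)) : Dual ℝ 𝔥 →ₗ[ℝ] Dual ℝ 𝔥 :=
  (Nat.card (S.parabolic J) : ℝ)⁻¹ •
    ∑ᶠ σ : S.parabolic J, ((σ : Dual ℝ 𝔥 ≃ₗ[ℝ] Dual ℝ 𝔥) : Dual ℝ 𝔥 →ₗ[ℝ] Dual ℝ 𝔥)

/-- `Y` is a `W`-invariant convex subcone (with zero) of the Tits cone. -/
structure IsInvariantSubcone (Y : PointedCone ℝ (Dual ℝ 𝔥)) : Prop where
  subset_titsCone : (Y : Set (Dual ℝ 𝔥)) ⊆ S.titsCone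
  invariant : ∀ σ ∈ S.weyl, ∀ l ∈ Y, σ l ∈ Y

/-- The cross section lattice `Υ` of `Y`: the nonempty faces of `Y` whose relative interior meets
the closed chamber (a nonempty face of a cone with zero is again a cone with zero). -/
def crossSection (Y : PointedCone ℝ (Dual ℝ 𝔥)) : Set (PointedCone ℝ (Dual ℝ 𝔥)) :=
  {R | R.IsFaceOf Y ∧ (relInt (R : Set (Dual ℝ 𝔥)) ∩ S.closedChamber).Nonempty}

/-- The type map `υ`. -/
def typeMap (R : PointedCone ℝ (Dual ℝ 𝔥)) : Set (Fin n) :=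
  {i | S.refl i '' (R : Set (Dual ℝ 𝔥)) = R}

/-- The lower type map `υ_*`. -/
def lowerType (R : PointedCone ℝ (Dual ℝ 𝔥)) : Set (Fin n) :=
  {i | ∀ l ∈ R, S.refl i l = l}

/-- The upper type map `υ^*`. -/
def upperType (R : PointedCone ℝ (Dual ℝ 𝔥)) : Set (Fin n) := S.typeMap R \ S.lowerType R

/-- The subsets `J` of `υ^*(R)` all of whose components are of finite type. -/
def finiteIndices (R : PointedCone ℝ (Dual ℝ 𝔥)) : Set (Set (Fin n)) :=
  {J | J ⊆ S.upperType R ∧ S.finitePart J = J}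

end ReflectionDatum

end

/-! The main point is that every `p` in ri(R) ∩ C̄ lies in a stratum whose index set is of finite
type. Let J be the set of indices outside υ_* whose coroots vanish at `p`. Since `p` is relatively
interior and R is a face of a W-invariant cone, σ_i R = R for i ∈ J. Hence α_i, a multiple of some l
- σ_i l with l ∈ R, lies in span R. So `p` plus a small combination of roots of a component K of J
stays in R, thus in the Tits cone, and W_K can make any such combination dominant on K. Let x be a
dominant W_K-translate of a root, and v ∈ W_K with v(-x) dominant. As p + εx lies in C̄ for small ε,
x - vx is a nonnegative combination of the roots of K. It is nonnegative and not identically zero on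
the coroots of K, so K is of finite type by Vinberg's criterion (`isFiniteType_of_isComponent`).

Conversely, for J = J^0 some positive combination of the roots of J is positive on the coroots of J.
Adding a small multiple of it moves a point of ri(R) ∩ F_{υ_* ∪ J} into ri(R) ∩ F_{υ_*}. Averaging
over W_J kills the roots of J, so it undoes this move. It also maps ri(R) ∩ F_{υ_*} into the
stratum: elements of W_J preserve ri(R) and subtract nonnegative combinations of J-roots from a
chamber point, which cannot lower its values on coroots outside J (`mid_mem`, `mid_image`).
Nonemptiness follows, and ri(R ∩ C̄) = ri(R) ∩ F_{υ_*} (`relInt_inter_closedChamber`) gives the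
formulas with `mid`.

Finiteness of W_J (`finite_parabolic`) comes from a W_J-invariant positive definite form on the span
of the roots of J, for which an orbit is bounded and uniformly separated. The Coxeter input is the
exchange condition, derived from the disjointness of the translates of C. -/

open Filter Topology

/-! ### Relative interiors of convex cones -/

section RelInt

variable {V : Type*} [AddCommGroup V] [Module ℝ V]

/-- This removes topology from the relative interior: a point of a cone is relatively interior iff
one can move a little from it against every element of the cone. All later arguments use only this
criterion. -/
theorem mem_relInt_pointedCone [FiniteDimensional ℝ V] {R : PointedCone ℝ V} {x : V} :
    x ∈ relInt (R : Set V) ↔ x ∈ R ∧ ∀ y ∈ R, ∃ ε : ℝ, 0 < ε ∧ x - ε • y ∈ R := by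
  let _ : TopologicalSpace V := moduleTopology ℝ V
  have : IsModuleTopology ℝ V := ⟨rfl⟩
  have : ContinuousAdd V := IsModuleTopology.toContinuousAdd ℝ V
  change x ∈ intrinsicInterior ℝ (R : Set V) ↔ _
  constructor
  · intro hx
    refine ⟨intrinsicInterior_subset hx, fun y hy => ?_⟩
    obtain ⟨z, hz, rfl⟩ := mem_intrinsicInterior.1 hx
    have h0 : (0 : V) ∈ affineSpan ℝ (R : Set V) := subset_affineSpan ℝ _ R.zero_mem
    have hy' : y ∈ affineSpan ℝ (R : Set V) := subset_affineSpan ℝ _ hy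
    let f : ℝ → affineSpan ℝ (R : Set V) := fun t =>
      ⟨t • ((0 : V) -ᵥ y) +ᵥ (z : V), AffineSubspace.smul_vsub_vadd_mem _ t h0 hy' z.2⟩
    have hf : Continuous f := by
      refine Continuous.subtype_mk ?_ _
      simp only [vadd_eq_add]
      fun_prop
    have h1 : ∀ᶠ t in 𝓝 (0 : ℝ), f t ∈ ((↑) ⁻¹' (R : Set V) : Set (affineSpan ℝ (R : Set V))) := by
      apply hf.continuousAt.eventually_mem
      have : f 0 = z := by ext; simp [f]
      rw [this]
      exact mem_interior_iff_mem_nhds.1 hz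
    have h2 : ∀ᶠ t in 𝓝[>] (0 : ℝ), f t ∈ ((↑) ⁻¹' (R : Set V) : Set (affineSpan ℝ (R : Set V))) :=
      h1.filter_mono nhdsWithin_le_nhds
    obtain ⟨t, ht, ht0⟩ := (h2.and self_mem_nhdsWithin).exists
    refine ⟨t, ht0, ?_⟩
    have : (f t : V) = z - t • y := by simp [f, sub_eq_add_neg, add_comm]
    rw [← this]
    exact ht
  · rintro ⟨hx, H⟩
    -- With a basis `b` of the span inside R, a neighbourhood of `x` is covered by the translated
    -- orthant x - ε ∑ b + cone(b), which lies in R. The coordinates are extended to all of V to be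
    -- continuous there.
    obtain ⟨b, hbR, hspan, hli⟩ := exists_linearIndependent ℝ (R : Set V)
    have hbfin : b.Finite := hli.setFinite
    have : Fintype b := hbfin.fintype
    let B := Basis.span hli
    have hφ : ∀ y : b, ∃ φ : V →ₗ[ℝ] ℝ,
        φ ∘ₗ (Submodule.span ℝ (Set.range ((↑) : b → V))).subtype = B.coord y :=
      fun y => LinearMap.exists_extend _
    choose φ hφ using hφ
    have hexp : ∀ v ∈ Submodule.span ℝ (R : Set V), v = ∑ y : b, φ y v • (y : V) := by
      intro v hv
      have hv' : v ∈ Submodule.span ℝ (Set.range ((↑) : b → V)) := by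
        rw [Subtype.range_coe, hspan]; exact hv
      have := congrArg Subtype.val (B.sum_repr ⟨v, hv'⟩)
      conv_lhs => rw [show v = ((⟨v, hv'⟩ : Submodule.span ℝ (Set.range ((↑) : b → V))) : V) from rfl,
        ← this]
      rw [Submodule.coe_sum]
      refine Finset.sum_congr rfl fun y _ => ?_
      have h3 := LinearMap.congr_fun (hφ y) ⟨v, hv'⟩
      simp only [LinearMap.comp_apply, Submodule.subtype_apply, Basis.coord_apply] at h3
      rw [h3, Submodule.coe_smul, Basis.span_apply]
    obtain ⟨ε, hε, hxe⟩ := H (∑ y : b, (y : V)) (R.sum_mem fun y _ => hbR y.2)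
    have hxs : x ∈ affineSpan ℝ (R : Set V) := subset_affineSpan ℝ _ hx
    refine mem_intrinsicInterior.2 ⟨⟨x, hxs⟩, ?_, rfl⟩
    rw [mem_interior]
    refine ⟨{p | ∀ y : b, -ε < φ y (p : V) - φ y x}, ?_, ?_, ?_⟩
    · rintro p hp
      have hps : (p : V) ∈ Submodule.span ℝ (R : Set V) := affineSpan_subset_span p.2
      have hxs' : x ∈ Submodule.span ℝ (R : Set V) := Submodule.subset_span hx
      have hpe : (p : V) = (x - ε • ∑ y : b, (y : V)) +
          ∑ y : b, (ε + φ y ((p : V) - x)) • (y : V) := by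
        have := hexp _ (Submodule.sub_mem _ hps hxs')
        simp only [add_smul, Finset.sum_add_distrib, ← Finset.smul_sum]
        rw [← this]; abel
      change (p : V) ∈ R
      rw [hpe]
      refine R.add_mem hxe (R.sum_mem fun y _ => R.smul_mem ?_ (hbR y.2))
      have := hp y
      rw [map_sub]; linarith
    · rw [Set.ofPred_forall]
      refine isOpen_iInter_of_finite fun y => ?_
      have hc : Continuous (φ y) := IsModuleTopology.continuous_of_linearMap (φ y)
      exact isOpen_lt continuous_const ((hc.comp continuous_subtype_val).sub continuous_const)
    · intro y
      simpa using hε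

variable {R : PointedCone ℝ V}

theorem sub_smul_mem_of_le {x y : V} (hx : x ∈ R) {ε δ : ℝ} (hδ : 0 ≤ δ) (hε : 0 < ε) (hle : δ ≤ ε)
    (h : x - ε • y ∈ R) : x - δ • y ∈ R := by
  have : x - δ • y = (1 - δ / ε) • x + (δ / ε) • (x - ε • y) := by
    rw [smul_sub, smul_smul, div_mul_cancel₀ _ hε.ne', sub_smul, one_smul]; abel
  rw [this]
  have h1 : δ / ε ≤ 1 := (div_le_one hε).2 hle
  exact R.add_mem (R.smul_mem (by linarith) hx) (R.smul_mem (by positivity) h)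

theorem exists_sub_eq_of_mem_span {v : V}
    (hv : v ∈ Submodule.span ℝ (R : Set V)) : ∃ p ∈ R, ∃ q ∈ R, v = p - q := by
  induction hv using Submodule.span_induction with
  | mem x hx => exact ⟨x, hx, 0, R.zero_mem, by simp⟩
  | zero => exact ⟨0, R.zero_mem, 0, R.zero_mem, by simp⟩
  | add x y _ _ hx hy =>
    obtain ⟨p, hp, q, hq, rfl⟩ := hx
    obtain ⟨p', hp', q', hq', rfl⟩ := hy
    exact ⟨p + p', R.add_mem hp hp', q + q', R.add_mem hq hq', by abel⟩
  | smul c x _ hx =>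
    obtain ⟨p, hp, q, hq, rfl⟩ := hx
    rcases le_total 0 c with hc | hc
    · exact ⟨c • p, R.smul_mem hc hp, c • q, R.smul_mem hc hq, smul_sub _ _ _⟩
    · refine ⟨(-c) • q, R.smul_mem (by linarith) hq, (-c) • p, R.smul_mem (by linarith) hp, ?_⟩
      rw [smul_sub, neg_smul, neg_smul]; abel

variable [FiniteDimensional ℝ V]

theorem relInt_subset_pointedCone {x : V} (hx : x ∈ relInt (R : Set V)) : x ∈ R :=
  (mem_relInt_pointedCone.1 hx).1

theorem add_mem_relInt {x y : V} (hx : x ∈ relInt (R : Set V)) (hy : y ∈ R) :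
    x + y ∈ relInt (R : Set V) := by
  obtain ⟨hx, H⟩ := mem_relInt_pointedCone.1 hx
  refine mem_relInt_pointedCone.2 ⟨R.add_mem hx hy, fun z hz => ?_⟩
  obtain ⟨ε, hε, h⟩ := H z hz
  refine ⟨ε, hε, ?_⟩
  rw [add_sub_right_comm]
  exact R.add_mem h hy

theorem smul_mem_relInt {x : V} (hx : x ∈ relInt (R : Set V)) {c : ℝ} (hc : 0 < c) :
    c • x ∈ relInt (R : Set V) := by
  obtain ⟨hx, H⟩ := mem_relInt_pointedCone.1 hx
  refine mem_relInt_pointedCone.2 ⟨R.smul_mem hc.le hx, fun z hz => ?_⟩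
  obtain ⟨ε, hε, h⟩ := H z hz
  refine ⟨c * ε, mul_pos hc hε, ?_⟩
  rw [mul_smul, ← smul_sub]
  exact R.smul_mem hc.le h

theorem eventually_sub_smul_mem {x y : V} (hx : x ∈ relInt (R : Set V)) (hy : y ∈ R) :
    ∀ᶠ ε in 𝓝[>] (0 : ℝ), x - ε • y ∈ R := by
  obtain ⟨hx, H⟩ := mem_relInt_pointedCone.1 hx
  obtain ⟨ε, hε, h⟩ := H y hy
  filter_upwards [Ioc_mem_nhdsGT hε] with δ hδ
  exact sub_smul_mem_of_le hx hδ.1.le hε hδ.2 h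

theorem eventually_add_smul_mem_relInt {x v : V} (hx : x ∈ relInt (R : Set V))
    (hv : v ∈ Submodule.span ℝ (R : Set V)) :
    ∀ᶠ ε in 𝓝[>] (0 : ℝ), x + ε • v ∈ relInt (R : Set V) := by
  obtain ⟨p, hp, q, hq, rfl⟩ := exists_sub_eq_of_mem_span hv
  have hx' : (2⁻¹ : ℝ) • x ∈ relInt (R : Set V) := smul_mem_relInt hx (by norm_num)
  filter_upwards [eventually_sub_smul_mem hx' hq, self_mem_nhdsWithin] with ε h hε
  have : x + ε • (p - q) = (2⁻¹ : ℝ) • x + (((2⁻¹ : ℝ) • x - ε • q) + ε • p) := by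
    have : x = (2⁻¹ : ℝ) • x + (2⁻¹ : ℝ) • x := by rw [← add_smul]; norm_num
    conv_lhs => rw [this]
    rw [smul_sub]; abel
  rw [this]
  exact add_mem_relInt hx' (R.add_mem h (R.smul_mem (le_of_lt hε) hp))

theorem sum_mem_relInt {ι : Type*} {s : Finset ι} (hs : s.Nonempty) {f : ι → V}
    (hf : ∀ i ∈ s, f i ∈ relInt (R : Set V)) : ∑ i ∈ s, f i ∈ relInt (R : Set V) := by
  induction hs using Finset.Nonempty.cons_induction with
  | singleton a => simpa using hf
  | cons a s ha hs ih =>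
    rw [Finset.sum_cons]
    refine add_mem_relInt (hf a (Finset.mem_cons_self _ _)) (relInt_subset_pointedCone (ih ?_))
    exact fun i hi => hf i (Finset.mem_cons_of_mem hi)

theorem map_mem_relInt {σ : V ≃ₗ[ℝ] V} (hσ : σ '' (R : Set V) = R) {x : V}
    (hx : x ∈ relInt (R : Set V)) : σ x ∈ relInt (R : Set V) := by
  have hmap : ∀ y ∈ R, σ y ∈ R := fun y hy => by
    have : σ y ∈ σ '' (R : Set V) := ⟨y, hy, rfl⟩
    rwa [hσ] at this
  obtain ⟨hx, H⟩ := mem_relInt_pointedCone.1 hx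
  refine mem_relInt_pointedCone.2 ⟨hmap x hx, fun y hy => ?_⟩
  have hy' : y ∈ σ '' (R : Set V) := by rw [hσ]; exact hy
  obtain ⟨z, hz, rfl⟩ := hy'
  obtain ⟨ε, hε, h⟩ := H z hz
  refine ⟨ε, hε, ?_⟩
  rw [← map_smul, ← map_sub]
  exact hmap _ h

end RelInt

namespace ReflectionDatum

/-! ### Words in the simple reflections -/

section Words

variable {𝔥 : Type*} [AddCommGroup 𝔥] [Module ℝ 𝔥] {n : ℕ} {S : ReflectionDatum 𝔥 n}

theorem cartan_apply (i j : Fin n) : S.cartan i j = S.α j (S.h i) := rfl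

theorem refl_refl (i : Fin n) (l : Dual ℝ 𝔥) : S.refl i (S.refl i l) = l := by
  simp only [refl_apply, LinearMap.sub_apply, LinearMap.smul_apply, S.pairing_self, smul_eq_mul]
  module

theorem refl_mul_self (i : Fin n) : S.refl i * S.refl i = 1 :=
  LinearEquiv.ext fun l => refl_refl i l

theorem refl_apply_coroot_self (i : Fin n) (l : Dual ℝ 𝔥) : S.refl i l (S.h i) = - l (S.h i) := by
  simp only [refl_apply, LinearMap.sub_apply, LinearMap.smul_apply, S.pairing_self, smul_eq_mul]
  ring

theorem refl_ne_one (i : Fin n) : S.refl i ≠ 1 := by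
  intro h
  have h1 := refl_apply_coroot_self (S := S) i (S.α i)
  rw [h, LinearEquiv.coe_one, id, S.pairing_self] at h1
  norm_num at h1

theorem refl_mem_weyl (i : Fin n) : S.refl i ∈ S.weyl := Subgroup.subset_closure ⟨i, rfl⟩

theorem refl_mem_parabolic {J : Set (Fin n)} {i : Fin n} (hi : i ∈ J) : S.refl i ∈ S.parabolic J :=
  Subgroup.subset_closure ⟨i, hi, rfl⟩

theorem parabolic_le_weyl (J : Set (Fin n)) : S.parabolic J ≤ S.weyl :=
  Subgroup.closure_mono (Set.image_subset_range _ _)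

/-- The product of simple reflections spelled by a list of indices. -/
def wordProd (S : ReflectionDatum 𝔥 n) (l : List (Fin n)) : Dual ℝ 𝔥 ≃ₗ[ℝ] Dual ℝ 𝔥 :=
  (l.map S.refl).prod

@[simp] theorem wordProd_nil : S.wordProd [] = 1 := rfl

@[simp] theorem wordProd_cons (i : Fin n) (l : List (Fin n)) :
    S.wordProd (i :: l) = S.refl i * S.wordProd l := by simp [wordProd]

theorem wordProd_append (l l' : List (Fin n)) :
    S.wordProd (l ++ l') = S.wordProd l * S.wordProd l' := by simp [wordProd]

theorem wordProd_mem_parabolic {J : Set (Fin n)} {l : List (Fin n)} (hl : ∀ i ∈ l, i ∈ J) :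
    S.wordProd l ∈ S.parabolic J := by
  induction l with
  | nil => exact one_mem _
  | cons i l ih =>
    rw [wordProd_cons]
    exact mul_mem (refl_mem_parabolic (hl i (by simp))) (ih fun j hj => hl j (by simp [hj]))

theorem exists_wordProd_of_mem_parabolic {J : Set (Fin n)} {w : Dual ℝ 𝔥 ≃ₗ[ℝ] Dual ℝ 𝔥}
    (hw : w ∈ S.parabolic J) : ∃ l : List (Fin n), (∀ i ∈ l, i ∈ J) ∧ S.wordProd l = w := by
  induction hw using Subgroup.closure_induction_left with
  | one => exact ⟨[], by simp, rfl⟩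
  | mul_left x hx y _ ih =>
    obtain ⟨i, hi, rfl⟩ := hx
    obtain ⟨l, hl, rfl⟩ := ih
    exact ⟨i :: l, by simpa [hi] using hl, by simp⟩
  | inv_mul_cancel x hx y _ ih =>
    obtain ⟨i, hi, rfl⟩ := hx
    obtain ⟨l, hl, rfl⟩ := ih
    refine ⟨i :: l, by simpa [hi] using hl, ?_⟩
    rw [wordProd_cons, inv_eq_of_mul_eq_one_right (refl_mul_self i)]

theorem weyl_eq_parabolic : S.weyl = S.parabolic Set.univ := by
  rw [weyl, parabolic, Set.image_univ]

theorem wordProd_mem_weyl (l : List (Fin n)) : S.wordProd l ∈ S.weyl :=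
  weyl_eq_parabolic (S := S) ▸ wordProd_mem_parabolic fun _ _ => trivial

theorem exists_wordProd_of_mem_weyl {w : Dual ℝ 𝔥 ≃ₗ[ℝ] Dual ℝ 𝔥}
    (hw : w ∈ S.weyl) : ∃ l : List (Fin n), S.wordProd l = w := by
  rw [weyl_eq_parabolic] at hw
  obtain ⟨l, -, h⟩ := exists_wordProd_of_mem_parabolic hw
  exact ⟨l, h⟩

theorem parabolic_apply_eq_self {J : Set (Fin n)} {w : Dual ℝ 𝔥 ≃ₗ[ℝ] Dual ℝ 𝔥}
    (hw : w ∈ S.parabolic J) {l : Dual ℝ 𝔥} (hl : ∀ i ∈ J, l (S.h i) = 0) : w l = l := by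
  induction hw using Subgroup.closure_induction with
  | mem x hx =>
    obtain ⟨i, hi, rfl⟩ := hx
    simp [refl_apply, hl i hi]
  | one => rfl
  | mul x y _ _ hx hy => rw [LinearEquiv.mul_apply, hy, hx]
  | inv x _ hx =>
    conv_lhs => rw [← hx]
    rw [← LinearEquiv.mul_apply, inv_mul_cancel, LinearEquiv.coe_one, id]

theorem parabolic_induction {J : Set (Fin n)} {p : (Dual ℝ 𝔥 ≃ₗ[ℝ] Dual ℝ 𝔥) → Prop}
    (one : p 1) (refl_mul : ∀ i ∈ J, ∀ w ∈ S.parabolic J, p w → p (S.refl i * w))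
    {w : Dual ℝ 𝔥 ≃ₗ[ℝ] Dual ℝ 𝔥} (hw : w ∈ S.parabolic J) : p w := by
  obtain ⟨l, hl, rfl⟩ := exists_wordProd_of_mem_parabolic hw
  clear hw
  induction l with
  | nil => exact one
  | cons i l ih =>
    have hl' : ∀ j ∈ l, j ∈ J := fun j hj => hl j (by simp [hj])
    rw [wordProd_cons]
    exact refl_mul i (hl i (by simp)) _ (wordProd_mem_parabolic hl') (ih hl')

end Words

/-! ### Chambers, the exchange condition and the Tits cone -/

section CoxeterSystem

variable {𝔥 : Type*} [AddCommGroup 𝔥] [Module ℝ 𝔥] {n : ℕ} {S : ReflectionDatum 𝔥 n}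

theorem mem_openChamber {l : Dual ℝ 𝔥} : l ∈ S.openChamber ↔ ∀ i, 0 < l (S.h i) := Iff.rfl

theorem mem_closedChamber {l : Dual ℝ 𝔥} : l ∈ S.closedChamber ↔ ∀ i, 0 ≤ l (S.h i) := Iff.rfl

theorem exists_dual_apply_ne_zero (i : Fin n) : ∃ l : Dual ℝ 𝔥, l (S.h i) ≠ 0 :=
  ⟨S.α i, by rw [S.pairing_self]; norm_num⟩

theorem IsLinearCoxeterSystem.exists_mem_openChamber (hS : S.IsLinearCoxeterSystem) :
    ∃ c, c ∈ S.openChamber := by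
  have h : ∀ i, ∃ l ∈ S.closedChamber, 0 < l (S.h i) := by
    intro i
    by_contra! hc
    have hle : Submodule.span ℝ (S.closedChamber : Set (Dual ℝ 𝔥)) ≤
        LinearMap.ker (Dual.eval ℝ 𝔥 (S.h i)) := by
      rw [Submodule.span_le]
      intro l hl
      exact le_antisymm (hc l hl) (hl i)
    rw [hS.span_chamber] at hle
    obtain ⟨l, hl⟩ := exists_dual_apply_ne_zero (S := S) i
    exact hl (hle (Submodule.mem_top (x := l)))
  choose f hf hpos using h
  refine ⟨∑ j, f j, fun i => ?_⟩
  rw [LinearMap.sum_apply]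
  exact Finset.sum_pos' (fun j _ => hf j i) ⟨i, Finset.mem_univ _, hpos i⟩

theorem IsLinearCoxeterSystem.eq_one_of_mem (hS : S.IsLinearCoxeterSystem)
    {w : Dual ℝ 𝔥 ≃ₗ[ℝ] Dual ℝ 𝔥} (hw : w ∈ S.weyl) {x : Dual ℝ 𝔥} (hx : x ∈ S.openChamber)
    (hwx : w x ∈ S.openChamber) : w = 1 := by
  by_contra hne
  have := hS.disjoint_translate w hw hne
  exact Set.notMem_empty _ (this ▸ ⟨⟨x, hx, rfl⟩, hwx⟩ : w x ∈ (∅ : Set (Dual ℝ 𝔥)))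

/-- `w C` lies strictly on the positive side of the `i`-th hyperplane. -/
def IsPos (S : ReflectionDatum 𝔥 n) (w : Dual ℝ 𝔥 ≃ₗ[ℝ] Dual ℝ 𝔥) (i : Fin n) : Prop :=
  ∀ x ∈ S.openChamber, 0 < w x (S.h i)

/-- `w C` lies strictly on the negative side of the `i`-th hyperplane. -/
def IsNeg (S : ReflectionDatum 𝔥 n) (w : Dual ℝ 𝔥 ≃ₗ[ℝ] Dual ℝ 𝔥) (i : Fin n) : Prop :=
  ∀ x ∈ S.openChamber, w x (S.h i) < 0

theorem IsPos.refl_mul {w : Dual ℝ 𝔥 ≃ₗ[ℝ] Dual ℝ 𝔥} {i : Fin n} (h : S.IsPos w i) :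
    S.IsNeg (S.refl i * w) i := fun x hx => by
  rw [LinearEquiv.mul_apply, refl_apply_coroot_self]
  exact neg_neg_of_pos (h x hx)

theorem IsNeg.refl_mul {w : Dual ℝ 𝔥 ≃ₗ[ℝ] Dual ℝ 𝔥} {i : Fin n} (h : S.IsNeg w i) :
    S.IsPos (S.refl i * w) i := fun x hx => by
  rw [LinearEquiv.mul_apply, refl_apply_coroot_self]
  exact neg_pos_of_neg (h x hx)

theorem add_smul_mem_openChamber {x c : Dual ℝ 𝔥} (hx : x ∈ S.closedChamber)
    (hc : c ∈ S.openChamber) {ε : ℝ} (hε : 0 < ε) : x + ε • c ∈ S.openChamber := fun i => by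
  have h1 := hx i
  have h2 := mul_pos hε (hc i)
  simp only [LinearMap.add_apply, LinearMap.smul_apply, smul_eq_mul]
  linarith

/-- If w x lay on the i-th hyperplane for some x in C, then w⁻¹ σ_i w would fix x and hence be 1. By
convexity of C, no hyperplane can then have points of w C on both sides. -/
theorem IsLinearCoxeterSystem.isPos_or_isNeg (hS : S.IsLinearCoxeterSystem)
    {w : Dual ℝ 𝔥 ≃ₗ[ℝ] Dual ℝ 𝔥} (hw : w ∈ S.weyl) (i : Fin n) : S.IsPos w i ∨ S.IsNeg w i := by
  have hne : ∀ x ∈ S.openChamber, w x (S.h i) ≠ 0 := by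
    intro x hx h0
    have h1 : (w⁻¹ * S.refl i * w) x = x := by
      rw [LinearEquiv.mul_apply, LinearEquiv.mul_apply, refl_apply, h0, zero_smul, sub_zero,
        ← LinearEquiv.mul_apply, inv_mul_cancel, LinearEquiv.coe_one, id]
    have h2 := hS.eq_one_of_mem (mul_mem (mul_mem (inv_mem hw) (refl_mem_weyl i)) hw) hx
      (by rwa [h1])
    apply refl_ne_one (S := S) i
    calc S.refl i = w * (w⁻¹ * S.refl i * w) * w⁻¹ := by group
      _ = 1 := by rw [h2]; group
  by_contra! h
  simp only [IsPos, IsNeg, not_forall, not_lt] at h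
  obtain ⟨⟨x, hx, hx'⟩, y, hy, hy'⟩ := h
  have hxn := lt_of_le_of_ne hx' (hne x hx)
  have hyp := lt_of_le_of_ne hy' (hne y hy).symm
  refine hne ((w y (S.h i)) • x + (-(w x (S.h i))) • y) (fun j => ?_) ?_
  · have h1 := mul_pos hyp (hx j)
    have h2 := mul_pos (neg_pos.2 hxn) (hy j)
    simp only [LinearMap.add_apply, LinearMap.smul_apply, smul_eq_mul]
    linarith
  · simp only [map_add, map_smul, LinearMap.add_apply, LinearMap.smul_apply, smul_eq_mul]
    ring

theorem IsPos.nonneg (hS : S.IsLinearCoxeterSystem) {w : Dual ℝ 𝔥 ≃ₗ[ℝ] Dual ℝ 𝔥} {i : Fin n}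
    (h : S.IsPos w i) {x : Dual ℝ 𝔥} (hx : x ∈ S.closedChamber) : 0 ≤ w x (S.h i) := by
  obtain ⟨c, hc⟩ := hS.exists_mem_openChamber
  have key : ∀ ε : ℝ, 0 < ε → 0 ≤ w x (S.h i) + ε * w c (S.h i) := by
    intro ε hε
    have := h _ (add_smul_mem_openChamber hx hc hε)
    simp only [map_add, map_smul, LinearMap.add_apply, LinearMap.smul_apply, smul_eq_mul] at this
    exact this.le
  by_contra! hneg
  have hcpos := h c hc
  have := key (-(w x (S.h i)) / (2 * w c (S.h i))) (by apply div_pos <;> linarith)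
  have h2 : -(w x (S.h i)) / (2 * w c (S.h i)) * w c (S.h i) = -(w x (S.h i)) / 2 := by
    field_simp
  rw [h2] at this
  linarith

theorem IsNeg.nonpos (hS : S.IsLinearCoxeterSystem) {w : Dual ℝ 𝔥 ≃ₗ[ℝ] Dual ℝ 𝔥} {i : Fin n}
    (h : S.IsNeg w i) {x : Dual ℝ 𝔥} (hx : x ∈ S.closedChamber) : w x (S.h i) ≤ 0 := by
  have := h.refl_mul.nonneg hS hx
  rw [LinearEquiv.mul_apply, refl_apply_coroot_self] at this
  linarith

/-- A point in the relative interior of the `i`-th wall. -/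
theorem IsLinearCoxeterSystem.exists_mem_wall [FiniteDimensional ℝ 𝔥]
    (hS : S.IsLinearCoxeterSystem) (i : Fin n) :
    ∃ x : Dual ℝ 𝔥, x (S.h i) = 0 ∧ ∀ j, j ≠ i → 0 < x (S.h j) := by
  let F : PointedCone ℝ (Dual ℝ 𝔥) :=
    { carrier := S.wall i
      add_mem' := fun {a b} ha hb => ⟨S.closedChamber.add_mem ha.1 hb.1, by
        rw [LinearMap.add_apply, ha.2, hb.2, add_zero]⟩
      zero_mem' := ⟨S.closedChamber.zero_mem, rfl⟩
      smul_mem' := fun c x hx => ⟨S.closedChamber.smul_mem c.2 hx.1, by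
        change (c : ℝ) * x (S.h i) = 0
        rw [hx.2, mul_zero]⟩ }
  have hdim := ((hS.facet_iff F).2 ⟨i, rfl⟩).2
  have hle : Submodule.span ℝ (F : Set (Dual ℝ 𝔥)) ≤ LinearMap.ker (Dual.eval ℝ 𝔥 (S.h i)) := by
    rw [Submodule.span_le]
    exact fun l hl => hl.2
  have hker : finrank ℝ (LinearMap.ker (Dual.eval ℝ 𝔥 (S.h i))) + 1 = finrank ℝ (Dual ℝ 𝔥) := by
    apply Module.Dual.finrank_ker_add_one_of_ne_zero
    intro h
    obtain ⟨l, hl⟩ := exists_dual_apply_ne_zero (S := S) i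
    exact hl (LinearMap.congr_fun h l)
  -- The wall spans the whole hyperplane. If h_j vanished on the wall, h_j would be a multiple of
  -- h_i and the two walls would coincide.
  have hspan := Submodule.eq_of_le_of_finrank_eq hle (by omega)
  have hex : ∀ j, j ≠ i → ∃ x ∈ S.wall i, 0 < x (S.h j) := by
    intro j hj
    by_contra! hc
    have h0 : ∀ x : Dual ℝ 𝔥, x (S.h i) = 0 → x (S.h j) = 0 := by
      intro x hx
      have hx' : x ∈ Submodule.span ℝ (F : Set (Dual ℝ 𝔥)) := by rw [hspan]; exact hx
      have hle' : Submodule.span ℝ (F : Set (Dual ℝ 𝔥)) ≤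
          LinearMap.ker (Dual.eval ℝ 𝔥 (S.h j)) := by
        rw [Submodule.span_le]
        exact fun l hl => le_antisymm (hc l hl) (hl.1 j)
      exact hle' hx'
    have hprop : ∀ x : Dual ℝ 𝔥, x (S.h j) = x (S.h i) * (S.α i (S.h j) / 2) := by
      intro x
      have := h0 (x - (x (S.h i) / 2) • S.α i) (by
        simp [S.pairing_self])
      simp only [LinearMap.sub_apply, LinearMap.smul_apply, smul_eq_mul] at this
      linarith
    obtain ⟨c, hcC⟩ := hS.exists_mem_openChamber
    have hcne : S.α i (S.h j) / 2 ≠ 0 := by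
      intro h
      have := hprop c
      rw [h, mul_zero] at this
      exact (hcC j).ne' this
    apply hj
    apply hS.wall_injective
    ext x
    refine and_congr_right fun _ => ?_
    rw [hprop x]
    simp [hcne]
  have hex' : ∀ j, ∃ x ∈ S.wall i, j ≠ i → 0 < x (S.h j) := by
    intro j
    by_cases hj : j = i
    · exact ⟨0, F.zero_mem, fun h => absurd hj h⟩
    · obtain ⟨x, hx, h⟩ := hex j hj
      exact ⟨x, hx, fun _ => h⟩
  choose f hf hpos using hex'
  refine ⟨∑ j, f j, ?_, fun j hj => ?_⟩
  · rw [LinearMap.sum_apply]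
    exact Finset.sum_eq_zero fun j _ => (hf j).2
  · rw [LinearMap.sum_apply]
    exact Finset.sum_pos' (fun k _ => (hf k).1 j) ⟨j, Finset.mem_univ _, hpos j hj⟩

theorem mem_closedChamber_of_wall {i : Fin n} {x : Dual ℝ 𝔥} (h0 : x (S.h i) = 0)
    (hpos : ∀ j, j ≠ i → 0 < x (S.h j)) : x ∈ S.closedChamber := fun j => by
  by_cases hj : j = i
  · rw [hj, h0]
  · exact (hpos j hj).le

theorem IsLinearCoxeterSystem.nonneg_or_nonpos (hS : S.IsLinearCoxeterSystem)
    {w : Dual ℝ 𝔥 ≃ₗ[ℝ] Dual ℝ 𝔥} (hw : w ∈ S.weyl) (i : Fin n) {x y : Dual ℝ 𝔥}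
    (hx : x ∈ S.closedChamber) (hy : y ∈ S.closedChamber) (hpos : 0 < w x (S.h i)) :
    0 ≤ w y (S.h i) := by
  rcases hS.isPos_or_isNeg hw i with h | h
  · exact h.nonneg hS hy
  · exact absurd (h.nonpos hS hx) (not_le.2 hpos)

section

variable [FiniteDimensional ℝ 𝔥]

/-- A point of wall j is fixed by σ_j and positive on h_i, so h_i is nonnegative on all of σ_j C̄.
Evaluating at σ_j of a point of wall i gives the sign. -/
theorem IsLinearCoxeterSystem.cartan_nonpos (hS : S.IsLinearCoxeterSystem) {i j : Fin n}
    (hij : i ≠ j) : S.cartan i j ≤ 0 := by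
  obtain ⟨xi, hi0, hi⟩ := hS.exists_mem_wall i
  obtain ⟨xj, hj0, hj⟩ := hS.exists_mem_wall j
  have := hS.nonneg_or_nonpos (refl_mem_weyl j) i (mem_closedChamber_of_wall hj0 hj)
    (mem_closedChamber_of_wall hi0 hi) (by simpa [refl_apply, hj0] using hj i hij)
  simp only [refl_apply, LinearMap.sub_apply, LinearMap.smul_apply, smul_eq_mul, hi0,
    zero_sub, Left.nonneg_neg_iff, ← cartan_apply] at this
  exact nonpos_of_mul_nonpos_right this (hi j hij.symm)

/-- The same comparison of two wall points, now for σ_j σ_i. Only this weak bound on the product is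
needed for the symmetrization later. -/
theorem IsLinearCoxeterSystem.one_le_cartan_mul (hS : S.IsLinearCoxeterSystem) {i j : Fin n}
    (hij : i ≠ j) (h0 : S.cartan i j ≠ 0) : 1 ≤ S.cartan i j * S.cartan j i := by
  obtain ⟨xi, hi0, hi⟩ := hS.exists_mem_wall i
  obtain ⟨xj, hj0, hj⟩ := hS.exists_mem_wall j
  have hneg := lt_of_le_of_ne (hS.cartan_nonpos hij) h0
  have hval : ∀ x : Dual ℝ 𝔥, (S.refl j * S.refl i) x (S.h i) =
      x (S.h i) * (S.cartan i j * S.cartan j i - 1) - S.cartan i j * x (S.h j) := by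
    intro x
    simp only [LinearEquiv.mul_apply, refl_apply, LinearMap.sub_apply, LinearMap.smul_apply,
      smul_eq_mul, S.pairing_self, cartan_apply]
    ring
  have hp := hi j hij.symm
  have := hS.nonneg_or_nonpos (mul_mem (refl_mem_weyl j) (refl_mem_weyl i)) i
    (mem_closedChamber_of_wall hi0 hi) (mem_closedChamber_of_wall hj0 hj)
    (by rw [hval, hi0]; nlinarith)
  rw [hval, hj0, mul_zero, sub_zero] at this
  have := nonneg_of_mul_nonneg_right this (hj i hij)
  linarith

theorem IsLinearCoxeterSystem.cartan_ne_zero_symm (hS : S.IsLinearCoxeterSystem) {i j : Fin n}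
    (h0 : S.cartan i j ≠ 0) : S.cartan j i ≠ 0 := by
  by_cases hij : i = j
  · subst hij; exact h0
  · intro h
    have := hS.one_le_cartan_mul hij h0
    rw [h, mul_zero] at this
    norm_num at this

/-- The chambers v C and v σ_m C share the wall v(wall m) and are separated by the i-th hyperplane,
which must therefore contain that wall. Near the wall, v⁻¹ σ_i v and σ_m then have the same effect
on C. -/
theorem IsLinearCoxeterSystem.refl_mul_eq_mul_refl (hS : S.IsLinearCoxeterSystem)
    {v : Dual ℝ 𝔥 ≃ₗ[ℝ] Dual ℝ 𝔥} (hv : v ∈ S.weyl) {i m : Fin n} (hpos : S.IsPos v i)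
    (hneg : S.IsNeg (v * S.refl m) i) : S.refl i * v = v * S.refl m := by
  obtain ⟨x, hx0, hx⟩ := hS.exists_mem_wall m
  have hxC := mem_closedChamber_of_wall hx0 hx
  have hrx : S.refl m x = x := by simp [refl_apply, hx0]
  have hker0 : v x (S.h i) = 0 := by
    refine le_antisymm ?_ (hpos.nonneg hS hxC)
    have := hneg.nonpos hS hxC
    rwa [LinearEquiv.mul_apply, hrx] at this
  -- the functional `z ↦ (v z)(h i)` is a positive multiple of `z ↦ z (h m)`
  have hprop : ∀ z : Dual ℝ 𝔥, v z (S.h i) = z (S.h m) * (v (S.α m) (S.h i) / 2) := by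
    have hker : ∀ z : Dual ℝ 𝔥, z (S.h m) = 0 → v z (S.h i) = 0 := by
      have hle : ∀ z : Dual ℝ 𝔥, z (S.h m) = 0 → 0 ≤ v z (S.h i) := by
        intro z hz
        have hev : ∀ᶠ ε in 𝓝[>] (0 : ℝ), ∀ j, 0 ≤ (x + ε • z) (S.h j) := by
          rw [eventually_all]
          intro j
          by_cases hj : j = m
          · subst hj; simp [hx0, hz]
          · have hcont : Continuous fun ε : ℝ => x (S.h j) + ε * z (S.h j) := by fun_prop
            have : ∀ᶠ ε in 𝓝 (0 : ℝ), 0 < x (S.h j) + ε * z (S.h j) :=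
              hcont.continuousAt.eventually_const_lt (by simpa using hx j hj)
            filter_upwards [this.filter_mono nhdsWithin_le_nhds] with ε hε
            simpa using hε.le
        obtain ⟨ε, hε, hε0⟩ := (hev.and self_mem_nhdsWithin).exists
        have := hpos.nonneg hS hε
        rw [map_add, map_smul, LinearMap.add_apply, hker0, zero_add, LinearMap.smul_apply,
          smul_eq_mul] at this
        exact nonneg_of_mul_nonneg_right this hε0
      intro z hz
      refine le_antisymm ?_ (hle z hz)
      have := hle (-z) (by simp [hz])
      simpa using this
    intro z
    have := hker (z - (z (S.h m) / 2) • S.α m) (by simp [S.pairing_self])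
    simp only [map_sub, map_smul, LinearMap.sub_apply, LinearMap.smul_apply, smul_eq_mul] at this
    linarith
  set c := v (S.α m) (S.h i) / 2 with hc
  -- `a` is the root attached to the reflection `v⁻¹ * refl i * v`
  set a := v⁻¹ (S.α i) with ha
  have hva : v a = S.α i := by rw [ha, ← LinearEquiv.mul_apply, mul_inv_cancel]; rfl
  have hac : a (S.h m) * c = 2 := by rw [← hprop, hva, S.pairing_self]
  set t := v⁻¹ * S.refl i * v with ht
  have htz : ∀ z, t z = z - (z (S.h m) * c) • a := by
    intro z
    rw [ht, LinearEquiv.mul_apply, LinearEquiv.mul_apply, refl_apply, map_sub, map_smul, hprop,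
      ← LinearEquiv.mul_apply, inv_mul_cancel, LinearEquiv.coe_one, id]
  have htm : ∀ z, t z (S.h m) = - z (S.h m) := by
    intro z
    rw [htz, LinearMap.sub_apply, LinearMap.smul_apply, smul_eq_mul, mul_assoc, mul_comm c, hac]
    ring
  have hgx : (t * S.refl m) x = x := by
    rw [LinearEquiv.mul_apply, hrx, htz, hx0, zero_mul, zero_smul, sub_zero]
  have hgm : ∀ z, (t * S.refl m) z (S.h m) = z (S.h m) := by
    intro z
    rw [LinearEquiv.mul_apply, htm, refl_apply_coroot_self, neg_neg]
  have hev : ∀ z : Dual ℝ 𝔥, 0 < z (S.h m) →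
      ∀ᶠ ε in 𝓝[>] (0 : ℝ), x + ε • z ∈ S.openChamber := by
    intro z hz
    simp only [mem_openChamber]
    rw [eventually_all]
    intro j
    by_cases hj : j = m
    · subst hj
      filter_upwards [self_mem_nhdsWithin] with ε hε
      simpa [hx0] using mul_pos hε hz
    · have hcont : Continuous fun ε : ℝ => x (S.h j) + ε * z (S.h j) := by fun_prop
      have : ∀ᶠ ε in 𝓝 (0 : ℝ), 0 < x (S.h j) + ε * z (S.h j) :=
        hcont.continuousAt.eventually_const_lt (by simpa using hx j hj)
      filter_upwards [this.filter_mono nhdsWithin_le_nhds] with ε hε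
      simpa using hε
  have hαm : 0 < S.α m (S.h m) := by rw [S.pairing_self]; norm_num
  obtain ⟨ε, h1, h2⟩ := ((hev (S.α m) hαm).and
    (hev ((t * S.refl m) (S.α m)) (by rwa [hgm]))).exists
  -- `t * S.refl m` fixes the wall point `x` and preserves the value at h_m, so it sends some point
  -- of C close to `x` back into C.
  have hg : t * S.refl m = 1 := by
    refine hS.eq_one_of_mem (mul_mem (mul_mem (mul_mem (inv_mem hv) (refl_mem_weyl i)) hv)
      (refl_mem_weyl m)) h1 ?_
    rw [map_add, map_smul, hgx]
    exact h2
  have : t = S.refl m := by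
    rw [← mul_one t, ← refl_mul_self m, ← mul_assoc, hg, one_mul]
  rw [← this, ht]
  group

/-- The exchange condition. -/
theorem IsLinearCoxeterSystem.exchange (hS : S.IsLinearCoxeterSystem) {i : Fin n}
    (l : List (Fin n)) (hl : S.IsNeg (S.wordProd l) i) :
    ∃ l' : List (Fin n), l' ⊆ l ∧ l'.length < l.length ∧
      S.wordProd l' = S.refl i * S.wordProd l := by
  induction l using List.reverseRecOn with
  | nil =>
    obtain ⟨c, hc⟩ := hS.exists_mem_openChamber
    exact absurd (hl c hc) (not_lt.2 (hc i).le)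
  | append_singleton l m ih =>
    -- If the prefix is still on the positive side, the last letter `m` crosses the hyperplane and
    -- is the one to delete. Otherwise a letter of the prefix is deleted.
    rcases hS.isPos_or_isNeg (wordProd_mem_weyl l) i with hp | hn
    · refine ⟨l, by simp, by simp, ?_⟩
      rw [wordProd_append, wordProd_cons, wordProd_nil, mul_one] at hl ⊢
      rw [← mul_assoc, hS.refl_mul_eq_mul_refl (wordProd_mem_weyl l) hp hl, mul_assoc,
        refl_mul_self, mul_one]
    · obtain ⟨l', hsub, hlen, heq⟩ := ih hn
      refine ⟨l' ++ [m], ?_, by simpa using hlen, ?_⟩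
      · exact List.append_subset.2 ⟨fun x hx => List.mem_append_left _ (hsub hx), by simp⟩
      · rw [wordProd_append, heq, wordProd_append, mul_assoc]

/-- While some i ∈ K is negative, multiplying by σ_i shortens the word by exchange, so the process
stops. -/
theorem IsLinearCoxeterSystem.exists_parabolic_mul_isPos (hS : S.IsLinearCoxeterSystem)
    (K : Set (Fin n)) {w : Dual ℝ 𝔥 ≃ₗ[ℝ] Dual ℝ 𝔥} (hw : w ∈ S.weyl) :
    ∃ v ∈ S.parabolic K, ∀ i ∈ K, S.IsPos (v * w) i := by
  obtain ⟨l, rfl⟩ := exists_wordProd_of_mem_weyl hw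
  clear hw
  induction hlen : l.length using Nat.strong_induction_on generalizing l with
  | _ k ih =>
    by_cases h : ∀ i ∈ K, S.IsPos (S.wordProd l) i
    · exact ⟨1, one_mem _, by simpa using h⟩
    · push Not at h
      obtain ⟨i, hi, hni⟩ := h
      have hneg := (hS.isPos_or_isNeg (wordProd_mem_weyl l) i).resolve_left hni
      obtain ⟨l', -, hlt, heq⟩ := hS.exchange l hneg
      obtain ⟨v, hv, hpos⟩ := ih _ (hlen ▸ hlt) l' rfl
      refine ⟨v * S.refl i, mul_mem hv (refl_mem_parabolic hi), fun j hj => ?_⟩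
      rw [mul_assoc, ← heq]
      exact hpos j hj

theorem IsLinearCoxeterSystem.exists_parabolic_apply_nonneg (hS : S.IsLinearCoxeterSystem)
    (K : Set (Fin n)) {x : Dual ℝ 𝔥} (hx : x ∈ S.titsCone) :
    ∃ v ∈ S.parabolic K, ∀ i ∈ K, 0 ≤ v x (S.h i) := by
  simp only [titsCone, Set.mem_iUnion] at hx
  obtain ⟨w, hw, y, hy, rfl⟩ := hx
  obtain ⟨v, hv, hpos⟩ := hS.exists_parabolic_mul_isPos K hw
  exact ⟨v, hv, fun i hi => (hpos i hi).nonneg hS hy⟩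

/-- Induction on word length: a leading σ_i subtracts a nonnegative multiple of α_i if the tail is
positive at i. If not, exchange gives a shorter word for the same element, with letters still in J.
-/
theorem IsLinearCoxeterSystem.exists_sub_eq_sum (hS : S.IsLinearCoxeterSystem)
    {J : Set (Fin n)} {w : Dual ℝ 𝔥 ≃ₗ[ℝ] Dual ℝ 𝔥} (hw : w ∈ S.parabolic J) {x : Dual ℝ 𝔥}
    (hx : x ∈ S.closedChamber) :
    ∃ c : Fin n → ℝ, (∀ i, 0 ≤ c i) ∧ (∀ i ∉ J, c i = 0) ∧ w x = x - ∑ i, c i • S.α i := by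
  obtain ⟨l, hl, rfl⟩ := exists_wordProd_of_mem_parabolic hw
  clear hw
  induction hlen : l.length using Nat.strong_induction_on generalizing l with
  | _ k ih =>
    match l, hl, hlen with
    | [], _, _ => exact ⟨0, by simp, by simp, by simp⟩
    | i :: l, hl, hlen =>
      have hl' : ∀ j ∈ l, j ∈ J := fun j hj => hl j (by simp [hj])
      rcases hS.isPos_or_isNeg (wordProd_mem_weyl l) i with hp | hn
      · obtain ⟨c, hc, hcJ, heq⟩ := ih l.length (by simp [← hlen]) l hl' rfl
        have hnn := hp.nonneg hS hx
        refine ⟨c + Pi.single i (S.wordProd l x (S.h i)), fun j => ?_, fun j hj => ?_, ?_⟩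
        · exact add_nonneg (hc j) (by
            by_cases hji : j = i
            · subst hji; simpa using hnn
            · simp [hji])
        · have : j ≠ i := by rintro rfl; exact hj (hl j (by simp))
          simp [this, hcJ j hj]
        · rw [wordProd_cons, LinearEquiv.mul_apply, refl_apply]
          simp only [Pi.add_apply, add_smul, Finset.sum_add_distrib]
          rw [Finset.sum_eq_single_of_mem i (Finset.mem_univ _)
            (f := fun j => (Pi.single i (S.wordProd l x (S.h i)) : Fin n → ℝ) j • S.α j)
            (fun j _ hj => by simp [hj]), Pi.single_eq_same]
          conv_lhs => enter [1]; rw [heq]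
          abel
      · obtain ⟨l', hsub, hlt, heq⟩ := hS.exchange l hn
        rw [wordProd_cons, ← heq]
        exact ih l'.length (by simp [← hlen]; omega) l' (fun j hj => hl' j (hsub hj)) rfl

end

end CoxeterSystem

end ReflectionDatum

/-! ### Matrices with nonpositive off-diagonal entries -/

section ZMatrix

open Matrix

variable {ι : Type*}

/-- Moving from x in direction u, this is the moment of entering the nonnegative orthant: t = -min
x_j / u_j. -/
theorem exists_isMinOn_ratio [Fintype ι] {x u : ι → ℝ} (hu : ∀ i, 0 < u i) {k : ι} (hk : x k < 0) :
    ∃ i, ∃ t : ℝ, 0 < t ∧ x i + t * u i = 0 ∧ ∀ j, 0 ≤ x j + t * u j := by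
  obtain ⟨i, -, hi⟩ := Finset.exists_min_image Finset.univ (fun j => x j / u j)
    ⟨k, Finset.mem_univ _⟩
  have hik : x i / u i < 0 := (hi k (Finset.mem_univ _)).trans_lt (div_neg_of_neg_of_pos hk (hu k))
  refine ⟨i, -(x i / u i), by linarith, ?_, fun j => ?_⟩
  · have := (hu i).ne'
    field_simp
    ring
  · have h1 := hi j (Finset.mem_univ _)
    have h2 := mul_le_mul_of_nonneg_right h1 (hu j).le
    rw [div_mul_cancel₀ _ (hu j).ne'] at h2
    linarith

variable [DecidableEq ι] {A : Matrix ι ι ℝ}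

/-- Rescale to b = D⁻¹ A D with D = diag(u), whose row sums on `s` are positive. By AM-GM each edge
contributes at most -2 to b + bᵀ, against 4 on the diagonal. So if every vertex had two neighbours,
the total would be at most 0, a contradiction. -/
theorem exists_leaf (hZ : ∀ i j, i ≠ j → A i j ≤ 0) (hd : ∀ i, A i i = 2)
    (hp : ∀ i j, i ≠ j → A i j ≠ 0 → 1 ≤ A i j * A j i) {u : ι → ℝ} (hu : ∀ i, 0 < u i)
    {s : Finset ι} (hs : s.Nonempty) (hsu : ∀ i ∈ s, 0 < ∑ j ∈ s, A i j * u j) :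
    ∃ k ∈ s, ∀ i ∈ s, ∀ j ∈ s, i ≠ k → j ≠ k → A k i ≠ 0 → A k j ≠ 0 → i = j := by
  by_contra! hcon
  let b : ι → ι → ℝ := fun i j => A i j * u j / u i
  have hb : ∀ i j, i ≠ j → b i j + b j i ≤ 0 := fun i j hij => by
    have h1 : b i j ≤ 0 := div_nonpos_of_nonpos_of_nonneg
      (mul_nonpos_of_nonpos_of_nonneg (hZ i j hij) (hu j).le) (hu i).le
    have h2 : b j i ≤ 0 := div_nonpos_of_nonpos_of_nonneg
      (mul_nonpos_of_nonpos_of_nonneg (hZ j i hij.symm) (hu i).le) (hu j).le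
    linarith
  have hb2 : ∀ i j, i ≠ j → A i j ≠ 0 → b i j + b j i ≤ -2 := fun i j hij h0 => by
    have h1 : b i j ≤ 0 := div_nonpos_of_nonpos_of_nonneg
      (mul_nonpos_of_nonpos_of_nonneg (hZ i j hij) (hu j).le) (hu i).le
    have h2 : b j i ≤ 0 := div_nonpos_of_nonpos_of_nonneg
      (mul_nonpos_of_nonpos_of_nonneg (hZ j i hij.symm) (hu i).le) (hu j).le
    have h3 : b i j * b j i = A i j * A j i := by
      have := (hu i).ne'
      have := (hu j).ne'
      simp only [b]
      field_simp
    have h4 := hp i j hij h0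
    nlinarith [sq_nonneg (b i j - b j i)]
  have hbd : ∀ i, b i i = 2 := fun i => by
    simp only [b]
    rw [hd, mul_div_assoc, div_self (hu i).ne', mul_one]
  have hrow : ∀ i ∈ s, ∑ j ∈ s, (b i j + b j i) ≤ 0 := by
    intro i hi
    obtain ⟨j, hj, k, hk, hji, hki, hij, hik, hjk⟩ := hcon i hi
    have hj' : j ∈ s.erase i := Finset.mem_erase.2 ⟨hji, hj⟩
    have hk' : k ∈ (s.erase i).erase j :=
      Finset.mem_erase.2 ⟨hjk.symm, Finset.mem_erase.2 ⟨hki, hk⟩⟩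
    rw [← Finset.add_sum_erase _ _ hi, ← Finset.add_sum_erase _ _ hj',
      ← Finset.add_sum_erase _ _ hk']
    have h1 := hb2 i j hji.symm hij
    have h2 := hb2 i k hki.symm hik
    have h3 : ∑ l ∈ ((s.erase i).erase j).erase k, (b i l + b l i) ≤ 0 :=
      Finset.sum_nonpos fun l hl => by
        simp only [Finset.mem_erase] at hl
        exact hb i l (Ne.symm hl.2.2.1)
    have h4 := hbd i
    linarith
  have h1 : ∑ i ∈ s, ∑ j ∈ s, (b i j + b j i) ≤ 0 := Finset.sum_nonpos hrow
  have h2 : 0 < ∑ i ∈ s, ∑ j ∈ s, b i j := Finset.sum_pos (fun i hi => by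
    simp only [b]
    rw [← Finset.sum_div]
    exact div_pos (hsu i hi) (hu i)) hs
  have h3 : ∑ i ∈ s, ∑ j ∈ s, (b i j + b j i) = 2 * ∑ i ∈ s, ∑ j ∈ s, b i j := by
    simp only [Finset.sum_add_distrib]
    rw [Finset.sum_comm (f := fun i j => b j i), two_mul]
  linarith

/-- Deleting a leaf preserves the positivity of A u, as the deleted terms are nonpositive. The graph
is thus a forest, and the factor at a leaf is determined by its only neighbour. -/
theorem exists_symmetrization (hZ : ∀ i j, i ≠ j → A i j ≤ 0) (hd : ∀ i, A i i = 2)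
    (hp : ∀ i j, i ≠ j → A i j ≠ 0 → 1 ≤ A i j * A j i) {u : ι → ℝ} (hu : ∀ i, 0 < u i)
    (s : Finset ι) (hsu : ∀ i ∈ s, 0 < ∑ j ∈ s, A i j * u j) :
    ∃ d : ι → ℝ, (∀ i, 0 < d i) ∧ ∀ i ∈ s, ∀ j ∈ s, d i * A i j = d j * A j i := by
  have hsymm : ∀ i j, A i j ≠ 0 → A j i ≠ 0 := fun i j h h' => by
    by_cases hij : i = j
    · subst hij; exact h h'
    · have := hp i j hij h
      rw [h', mul_zero] at this
      norm_num at this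
  induction hn : s.card generalizing s with
  | zero => exact ⟨1, fun _ => one_pos, by simp [Finset.card_eq_zero.1 hn]⟩
  | succ m ih =>
    have hs : s.Nonempty := Finset.card_pos.1 (by omega)
    obtain ⟨k, hk, hleaf⟩ := exists_leaf hZ hd hp hu hs hsu
    obtain ⟨d, hd0, hdA⟩ := ih (s.erase k) (fun i hi => by
      have h1 := hsu i (Finset.mem_of_mem_erase hi)
      rw [← Finset.add_sum_erase _ _ hk] at h1
      have h2 : A i k * u k ≤ 0 :=
        mul_nonpos_of_nonpos_of_nonneg (hZ i k (Finset.ne_of_mem_erase hi)) (hu k).le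
      linarith) (by rw [Finset.card_erase_of_mem hk]; omega)
    have hext : ∃ c : ℝ, 0 < c ∧ ∀ j ∈ s, j ≠ k → c * A k j = d j * A j k := by
      by_cases h : ∃ j ∈ s, j ≠ k ∧ A k j ≠ 0
      · obtain ⟨j, hj, hjk, hkj⟩ := h
        have h1 := lt_of_le_of_ne (hZ k j hjk.symm) hkj
        have h2 := lt_of_le_of_ne (hZ j k hjk) (hsymm _ _ hkj)
        refine ⟨d j * A j k / A k j, div_pos_of_neg_of_neg (mul_neg_of_pos_of_neg (hd0 j) h2) h1,
          fun l hl hlk => ?_⟩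
        by_cases hkl : A k l = 0
        · have : A l k = 0 := by
            by_contra hne
            exact hsymm _ _ hne hkl
          rw [hkl, this, mul_zero, mul_zero]
        · rw [hleaf l hl j hj hlk hjk hkl hkj, div_mul_cancel₀ _ hkj]
      · push Not at h
        refine ⟨1, one_pos, fun j hj hjk => ?_⟩
        have : A j k = 0 := by
          by_contra hne
          exact hsymm _ _ hne (h j hj hjk)
        rw [h j hj hjk, this, mul_zero, mul_zero]
    obtain ⟨c, hc, hcA⟩ := hext
    refine ⟨Function.update d k c, fun i => ?_, fun i hi j hj => ?_⟩
    · by_cases hik : i = k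
      · subst hik; simpa using hc
      · simpa [hik] using hd0 i
    · by_cases hik : i = k
      · subst hik
        by_cases hjk : j = i
        · subst hjk; rfl
        · simpa [hjk] using hcA j hj hjk
      · by_cases hjk : j = k
        · subst hjk
          simpa [hik] using (hcA i hi hik).symm
        · simpa [hik, hjk] using hdA i (Finset.mem_erase.2 ⟨hik, hi⟩) j
            (Finset.mem_erase.2 ⟨hjk, hj⟩)

variable [Fintype ι]

/-- At the first t with x + t u ≥ 0, row i of A (x + t u) with (x + t u)_i = 0 is nonpositive,
whereas A x + t A u is positive there. -/
theorem nonneg_of_mulVec_nonneg (hZ : ∀ i j, i ≠ j → A i j ≤ 0) {u : ι → ℝ} (hu : ∀ i, 0 < u i)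
    (hAu : ∀ i, 0 < (A *ᵥ u) i) {x : ι → ℝ} (hx : ∀ i, 0 ≤ (A *ᵥ x) i) (i : ι) : 0 ≤ x i := by
  by_contra! hneg
  obtain ⟨i, t, ht, hi0, hi⟩ := exists_isMinOn_ratio hu hneg
  have h1 : (A *ᵥ (x + t • u)) i ≤ 0 := by
    refine Finset.sum_nonpos fun j _ => ?_
    by_cases hij : i = j
    · subst hij
      simp [hi0]
    · exact mul_nonpos_of_nonpos_of_nonneg (hZ i j hij) (hi j)
  rw [mulVec_add, mulVec_smul] at h1
  have h2 := mul_pos ht (hAu i)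
  have h3 := hx i
  simp only [Pi.add_apply, Pi.smul_apply, smul_eq_mul] at h1
  linarith

theorem eq_zero_of_mulVec_eq_zero (hZ : ∀ i j, i ≠ j → A i j ≤ 0) {u : ι → ℝ} (hu : ∀ i, 0 < u i)
    (hAu : ∀ i, 0 < (A *ᵥ u) i) {x : ι → ℝ} (hx : A *ᵥ x = 0) : x = 0 := by
  funext i
  refine le_antisymm ?_ (nonneg_of_mulVec_nonneg hZ hu hAu (fun i => by rw [hx]; rfl) i)
  have := nonneg_of_mulVec_nonneg hZ hu hAu (x := -x) (fun i => by simp [mulVec_neg, hx]) i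
  simpa using this

theorem exists_mulVec_eq (hZ : ∀ i j, i ≠ j → A i j ≤ 0) {u : ι → ℝ} (hu : ∀ i, 0 < u i)
    (hAu : ∀ i, 0 < (A *ᵥ u) i) (b : ι → ℝ) : ∃ x, A *ᵥ x = b := by
  have hinj : Function.Injective A.mulVec := fun x y hxy => by
    rw [← sub_eq_zero]
    apply eq_zero_of_mulVec_eq_zero hZ hu hAu
    rw [mulVec_sub, sub_eq_zero]
    exact hxy
  exact mulVec_surjective_iff_isUnit.2 (mulVec_injective_iff_isUnit.1 hinj) b

/-- The zero set of v is closed under passing to neighbours, so by connectedness it is empty or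
everything. -/
theorem forall_pos_of_mulVec_nonneg (hZ : ∀ i j, i ≠ j → A i j ≤ 0)
    (hconn : ∀ Z : Set ι, Z.Nonempty → (∀ i ∈ Z, ∀ j, A i j ≠ 0 → j ∈ Z) → Z = Set.univ)
    {v : ι → ℝ} (hv : ∀ i, 0 ≤ v i) (hAv : ∀ i, 0 ≤ (A *ᵥ v) i) (hne : v ≠ 0) (i : ι) :
    0 < v i := by
  refine lt_of_le_of_ne (hv i) fun h0 => hne ?_
  have huniv := hconn {i | v i = 0} ⟨i, h0.symm⟩ fun i hi j hij => by
    have hle : ∀ j ∈ Finset.univ, A i j * v j ≤ 0 := fun j _ => by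
      by_cases h : i = j
      · subst h; rw [show v i = 0 from hi, mul_zero]
      · exact mul_nonpos_of_nonpos_of_nonneg (hZ i j h) (hv j)
    have hsum : ∑ j, A i j * v j = 0 := le_antisymm (Finset.sum_nonpos hle) (hAv i)
    exact (mul_eq_zero.1 ((Finset.sum_eq_zero_iff_of_nonpos hle).1 hsum j
      (Finset.mem_univ _))).resolve_left hij
  funext j
  exact huniv.ge (Set.mem_univ j)

/-- Vinberg's criterion: a connected matrix with nonpositive off-diagonal entries is of finite
type if `A u` is nonnegative and nonzero for some nonnegative `u`. -/
theorem isFiniteTypeMatrix_of_connected {κ : Type} [Fintype κ] [DecidableEq κ]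
    {A : Matrix κ κ ℝ} (hZ : ∀ i j, i ≠ j → A i j ≤ 0)
    (hconn : ∀ Z : Set κ, Z.Nonempty → (∀ i ∈ Z, ∀ j, A i j ≠ 0 → j ∈ Z) → Z = Set.univ)
    {u : κ → ℝ} (hu : ∀ i, 0 ≤ u i) (hAu : ∀ i, 0 ≤ (A *ᵥ u) i) {k : κ}
    (hk : 0 < (A *ᵥ u) k) : IsFiniteTypeMatrix A := by
  have hu0 : u ≠ 0 := by rintro rfl; simp at hk
  have hupos := forall_pos_of_mulVec_nonneg hZ hconn hu hAu hu0
  have key : ∀ v : κ → ℝ, (∀ i, 0 ≤ (A *ᵥ v) i) → (∀ i, 0 < v i) ∨ v = 0 := by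
    intro v hv
    by_cases hv0 : ∀ i, 0 ≤ v i
    · by_cases hne : v = 0
      · exact Or.inr hne
      · exact Or.inl (forall_pos_of_mulVec_nonneg hZ hconn hv0 hv hne)
    · push Not at hv0
      obtain ⟨i, hi⟩ := hv0
      obtain ⟨i, t, ht, hi0, hi⟩ := exists_isMinOn_ratio hupos hi
      -- `v + t • u` is nonnegative with a zero entry, so it cannot be nonzero. But v = -t u
      -- contradicts (A u)_k > 0.
      have hz : v + t • u = 0 := by
        by_contra hne
        refine (forall_pos_of_mulVec_nonneg hZ hconn (v := v + t • u) hi (fun j => ?_) hne i).ne'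
          hi0
        rw [mulVec_add, mulVec_smul]
        exact add_nonneg (hv j) (mul_nonneg ht.le (hAu j))
      have hk' := hv k
      rw [eq_neg_of_add_eq_zero_left hz, mulVec_neg, mulVec_smul] at hk'
      have := mul_pos ht hk
      simp only [Pi.neg_apply, Pi.smul_apply, smul_eq_mul] at hk'
      linarith
  have hdet : A.det ≠ 0 := by
    intro hdet
    obtain ⟨v, hv, hAv⟩ := exists_mulVec_eq_zero_iff.2 hdet
    have h1 := (key v (fun i => by rw [hAv]; rfl)).resolve_right hv k
    have h2 := (key (-v) (fun i => by rw [mulVec_neg, hAv]; simp)).resolve_right (by simpa) k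
    rw [Pi.neg_apply] at h2
    linarith
  refine ⟨hdet, ?_, key⟩
  obtain ⟨w, hw⟩ := mulVec_surjective_iff_isUnit.2
    ((isUnit_iff_isUnit_det A).2 (isUnit_iff_ne_zero.2 hdet)) (fun _ => 1)
  have hw1 : ∀ i, (A *ᵥ w) i = 1 := fun i => congrFun hw i
  refine ⟨w, (key w fun i => by rw [hw1]; norm_num).resolve_right ?_, fun i => by
    rw [hw1]; norm_num⟩
  rintro rfl
  simpa using hw1 k

/-- Replace each product x_i x_j by its AM-GM bound weighted by u; the off-diagonal coefficients are
nonpositive, so the form can only decrease. This gives explicit positive definiteness when A u > 0.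
-/
theorem le_sum_mul_mul (hZ : ∀ i j, i ≠ j → A i j ≤ 0) {u d : ι → ℝ} (hu : ∀ i, 0 < u i)
    (hd0 : ∀ i, 0 < d i) (hsymm : ∀ i j, d i * A i j = d j * A j i) (x : ι → ℝ) :
    ∑ i, d i * (A *ᵥ u) i / u i * x i ^ 2 ≤ ∑ i, ∑ j, d i * A i j * (x i * x j) := by
  have h1 : ∑ i, d i * (A *ᵥ u) i / u i * x i ^ 2 =
      ∑ i, ∑ j, d i * A i j * (u j / u i * x i ^ 2) := by
    refine Finset.sum_congr rfl fun i _ => ?_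
    rw [mulVec, dotProduct, Finset.mul_sum, Finset.sum_div, Finset.sum_mul]
    exact Finset.sum_congr rfl fun j _ => by ring
  have h2 : ∑ i, ∑ j, d i * A i j * (u j / u i * x i ^ 2) =
      ∑ i, ∑ j, d i * A i j * (u i / u j * x j ^ 2) := by
    rw [Finset.sum_comm]
    exact Finset.sum_congr rfl fun i _ => Finset.sum_congr rfl fun j _ => by rw [hsymm]
  have h3 : ∑ i, ∑ j, d i * A i j * ((u j / u i * x i ^ 2 + u i / u j * x j ^ 2) / 2) ≤
      ∑ i, ∑ j, d i * A i j * (x i * x j) := by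
    refine Finset.sum_le_sum fun i _ => Finset.sum_le_sum fun j _ => ?_
    by_cases hij : i = j
    · subst hij
      rw [div_self (hu i).ne']
      apply le_of_eq; ring
    · apply mul_le_mul_of_nonpos_left _
        (mul_nonpos_of_nonneg_of_nonpos (hd0 i).le (hZ i j hij))
      have hi := hu i
      have hj := hu j
      have : (u j / u i * x i ^ 2 + u i / u j * x j ^ 2) / 2 - x i * x j =
          (u j * x i - u i * x j) ^ 2 / (2 * u i * u j) := by
        field_simp
        ring
      have h0 : 0 ≤ (u j * x i - u i * x j) ^ 2 / (2 * u i * u j) := by positivity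
      linarith
  have h4 : ∑ i, ∑ j, d i * A i j * ((u j / u i * x i ^ 2 + u i / u j * x j ^ 2) / 2) =
      (∑ i, ∑ j, d i * A i j * (u j / u i * x i ^ 2) +
        ∑ i, ∑ j, d i * A i j * (u i / u j * x j ^ 2)) / 2 := by
    simp only [← Finset.sum_add_distrib, Finset.sum_div]
    exact Finset.sum_congr rfl fun i _ => Finset.sum_congr rfl fun j _ => by ring
  rw [h1]
  rw [h4, ← h2] at h3
  linarith

end ZMatrix

theorem eventually_pos_add_mul {a : ℝ} (ha : 0 < a) (b : ℝ) :
    ∀ᶠ ε in 𝓝[>] (0 : ℝ), 0 < a + ε * b := by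
  have hcont : Continuous fun ε : ℝ => a + ε * b := by fun_prop
  exact (hcont.continuousAt.eventually_const_lt (by simpa using ha)).filter_mono
    nhdsWithin_le_nhds

theorem finite_of_separated_of_bounded {ι κ : Type*} [Fintype ι] (f : κ → ι → ℝ) {C r : ℝ}
    (hC : ∀ k, ‖f k‖ ≤ C) (hr : 0 < r) (hsep : ∀ k l, ‖f k - f l‖ < r → k = l) : Finite κ := by
  obtain ⟨t, -, htfin, hcov⟩ := Metric.finite_approx_of_totallyBounded
    (isCompact_closedBall (0 : ι → ℝ) C).totallyBounded _ (half_pos hr)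
  have hex : ∀ k, ∃ x : t, f k ∈ Metric.ball (x : ι → ℝ) (r / 2) := fun k => by
    have := hcov (mem_closedBall_zero_iff.2 (hC k))
    simp only [Set.mem_iUnion] at this
    obtain ⟨x, hx, h⟩ := this
    exact ⟨⟨x, hx⟩, h⟩
  choose g hg using hex
  have : Finite t := htfin
  refine Finite.of_injective g fun k l hkl => hsep k l ?_
  have h1 := hg k
  have h2 := hg l
  rw [← hkl] at h2
  rw [← dist_eq_norm]
  calc dist (f k) (f l) ≤ dist (f k) (g k) + dist (f l) (g k) := dist_triangle_right _ _ _
    _ < r / 2 + r / 2 := add_lt_add h1 h2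
    _ = r := by ring

namespace ReflectionDatum

/-! ### Finiteness of parabolic subgroups of finite type -/

section FiniteParabolic

variable {𝔥 : Type*} [AddCommGroup 𝔥] [Module ℝ 𝔥] {n : ℕ} {S : ReflectionDatum 𝔥 n}

theorem eventually_add_smul_mem_openChamber {J : Set (Fin n)} {p x : Dual ℝ 𝔥}
    (hp : p ∈ S.openFacet J) (hx : ∀ i ∈ J, 0 < x (S.h i)) :
    ∀ᶠ ε in 𝓝[>] (0 : ℝ), p + ε • x ∈ S.openChamber := by
  simp only [mem_openChamber]
  rw [eventually_all]
  intro i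
  by_cases hi : i ∈ J
  · filter_upwards [self_mem_nhdsWithin] with ε hε
    simpa [hp.1 i hi] using mul_pos hε (hx i hi)
  · filter_upwards [eventually_pos_add_mul (hp.2 i hi) (x (S.h i))] with ε hε
    simpa using hε

theorem eventually_add_smul_mem_closedChamber {J : Set (Fin n)} {p x : Dual ℝ 𝔥}
    (hp : p ∈ S.openFacet J) (hx : ∀ i ∈ J, 0 ≤ x (S.h i)) :
    ∀ᶠ ε in 𝓝[>] (0 : ℝ), p + ε • x ∈ S.closedChamber := by
  simp only [mem_closedChamber]
  rw [eventually_all]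
  intro i
  by_cases hi : i ∈ J
  · filter_upwards [self_mem_nhdsWithin] with ε hε
    simpa [hp.1 i hi] using mul_nonneg (le_of_lt hε) (hx i hi)
  · filter_upwards [eventually_pos_add_mul (hp.2 i hi) (x (S.h i))] with ε hε
    simpa using hε.le

/-- W_J fixes p, so adding small multiples of x and w x to p turns positivity on J alone into
membership in C. -/
theorem IsLinearCoxeterSystem.eq_one_of_pos (hS : S.IsLinearCoxeterSystem) {J : Set (Fin n)}
    {p : Dual ℝ 𝔥} (hp : p ∈ S.openFacet J) {w : Dual ℝ 𝔥 ≃ₗ[ℝ] Dual ℝ 𝔥} (hw : w ∈ S.parabolic J)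
    {x : Dual ℝ 𝔥} (hx : ∀ i ∈ J, 0 < x (S.h i)) (hwx : ∀ i ∈ J, 0 < w x (S.h i)) : w = 1 := by
  obtain ⟨ε, h1, h2⟩ := ((eventually_add_smul_mem_openChamber hp hx).and
    (eventually_add_smul_mem_openChamber hp hwx)).exists
  refine hS.eq_one_of_mem (parabolic_le_weyl J hw) h1 ?_
  rwa [map_add, map_smul, parabolic_apply_eq_self hw hp.1]

/-- The linear combination of the simple roots with given coefficients. -/
def rootComb (S : ReflectionDatum 𝔥 n) : (Fin n → ℝ) →ₗ[ℝ] Dual ℝ 𝔥 :=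
  Fintype.linearCombination ℝ S.α

theorem rootComb_apply (x : Fin n → ℝ) : S.rootComb x = ∑ j, x j • S.α j := rfl

theorem rootComb_apply_coroot (x : Fin n → ℝ) (i : Fin n) :
    S.rootComb x (S.h i) = ∑ j, S.cartan i j * x j := by
  rw [rootComb_apply, LinearMap.sum_apply]
  exact Finset.sum_congr rfl fun j _ => mul_comm _ _

theorem rootComb_single (i : Fin n) (c : ℝ) : S.rootComb (Pi.single i c) = c • S.α i := by
  simp [rootComb, Fintype.linearCombination_apply_single]

/-- There is a combination of the roots from `J` with positive coefficients which is positive on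
the coroots from `J`. -/
def IsPositiveType (S : ReflectionDatum 𝔥 n) (J : Set (Fin n)) : Prop :=
  ∃ u : Fin n → ℝ, (∀ i ∈ J, 0 < u i) ∧ (∀ i ∉ J, u i = 0) ∧ ∀ i ∈ J, 0 < S.rootComb u (S.h i)

open Classical in
/-- The matrix with the entries of the Cartan matrix on `J`, and `2` times the identity
elsewhere. -/
noncomputable def blockCartan (S : ReflectionDatum 𝔥 n) (J : Set (Fin n)) :
    Matrix (Fin n) (Fin n) ℝ :=
  Matrix.of fun i j => if i ∈ J ∧ j ∈ J then S.cartan i j else if i = j then 2 else 0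

open Matrix

theorem blockCartan_mulVec_of_mem {J : Set (Fin n)} {x : Fin n → ℝ} (hx : ∀ i ∉ J, x i = 0)
    {i : Fin n} (hi : i ∈ J) : (S.blockCartan J *ᵥ x) i = S.rootComb x (S.h i) := by
  rw [rootComb_apply_coroot]
  rw [mulVec, dotProduct]
  refine Finset.sum_congr rfl fun j _ => ?_
  by_cases hj : j ∈ J
  · simp [blockCartan, hi, hj]
  · simp [hx j hj]

theorem blockCartan_mulVec_of_notMem {J : Set (Fin n)} (x : Fin n → ℝ)
    {i : Fin n} (hi : i ∉ J) : (S.blockCartan J *ᵥ x) i = 2 * x i := by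
  rw [mulVec, dotProduct, Finset.sum_eq_single i]
  · simp [blockCartan, hi]
  · intro j _ hj
    simp [blockCartan, hi, hj.symm]
  · simp

theorem blockCartan_self (J : Set (Fin n)) (i : Fin n) : S.blockCartan J i i = 2 := by
  by_cases hi : i ∈ J
  · simp [blockCartan, hi, cartan_apply, S.pairing_self]
  · simp [blockCartan, hi]

theorem IsPositiveType.exists_blockCartan {J : Set (Fin n)} (hJ : S.IsPositiveType J) :
    ∃ u : Fin n → ℝ, (∀ i, 0 < u i) ∧ ∀ i, 0 < (S.blockCartan J *ᵥ u) i := by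
  classical
  obtain ⟨u, hu, hu0, hpos⟩ := hJ
  refine ⟨fun i => if i ∈ J then u i else 1, fun i => ?_, fun i => ?_⟩
  · dsimp only
    split_ifs with h
    · exact hu i h
    · exact one_pos
  · by_cases hi : i ∈ J
    · have : (S.blockCartan J *ᵥ fun i => if i ∈ J then u i else 1) i =
          (S.blockCartan J *ᵥ u) i := by
        rw [mulVec, mulVec, dotProduct, dotProduct]
        refine Finset.sum_congr rfl fun j _ => ?_
        by_cases hj : j ∈ J
        · simp [hj]
        · have hij : i ≠ j := by rintro rfl; exact hj hi
          simp [blockCartan, hj, hij]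
      rw [this, blockCartan_mulVec_of_mem hu0 hi]
      exact hpos i hi
    · rw [blockCartan_mulVec_of_notMem _ hi]
      simp [hi]

variable [FiniteDimensional ℝ 𝔥]

theorem IsLinearCoxeterSystem.blockCartan_nonpos (hS : S.IsLinearCoxeterSystem) (J : Set (Fin n))
    (i j : Fin n) (hij : i ≠ j) : S.blockCartan J i j ≤ 0 := by
  by_cases h : i ∈ J ∧ j ∈ J
  · simpa [blockCartan, h] using hS.cartan_nonpos hij
  · simp [blockCartan, h, hij]

theorem IsLinearCoxeterSystem.one_le_blockCartan_mul (hS : S.IsLinearCoxeterSystem)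
    (J : Set (Fin n)) (i j : Fin n) (hij : i ≠ j) (h0 : S.blockCartan J i j ≠ 0) :
    1 ≤ S.blockCartan J i j * S.blockCartan J j i := by
  by_cases h : i ∈ J ∧ j ∈ J
  · simp only [blockCartan, h, of_apply, and_self, if_true] at h0 ⊢
    exact hS.one_le_cartan_mul hij h0
  · simp [blockCartan, h, hij] at h0

/-- From c in C subtract the combination of J-roots with the same values on the coroots of J. Its
coefficients are nonnegative, so the values off J do not drop. -/
theorem IsLinearCoxeterSystem.exists_mem_openFacet (hS : S.IsLinearCoxeterSystem)
    {J : Set (Fin n)} (hJ : S.IsPositiveType J) : ∃ p, p ∈ S.openFacet J := by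
  classical
  obtain ⟨c, hc⟩ := hS.exists_mem_openChamber
  obtain ⟨u, hu, hAu⟩ := hJ.exists_blockCartan
  obtain ⟨d, hd⟩ := exists_mulVec_eq (hS.blockCartan_nonpos J) hu hAu
    (fun i => if i ∈ J then c (S.h i) else 0)
  have hd0 : ∀ i, 0 ≤ d i := nonneg_of_mulVec_nonneg (hS.blockCartan_nonpos J) hu hAu fun i => by
    rw [hd]
    dsimp only
    split_ifs
    · exact (hc i).le
    · exact le_rfl
  have hdJ : ∀ i ∉ J, d i = 0 := fun i hi => by
    have := congrFun hd i
    rw [blockCartan_mulVec_of_notMem _ hi] at this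
    simpa [hi] using this
  refine ⟨c - S.rootComb d, fun i hi => ?_, fun i hi => ?_⟩
  · rw [LinearMap.sub_apply, ← blockCartan_mulVec_of_mem hdJ hi, hd]
    simp [hi]
  · have h1 : S.rootComb d (S.h i) ≤ 0 := by
      rw [rootComb_apply_coroot]
      refine Finset.sum_nonpos fun j _ => ?_
      by_cases hij : i = j
      · subst hij; rw [hdJ i hi, mul_zero]
      · exact mul_nonpos_of_nonpos_of_nonneg (hS.cartan_nonpos hij) (hd0 j)
    have h2 := hc i
    rw [LinearMap.sub_apply]
    linarith

theorem IsLinearCoxeterSystem.rootComb_injOn (hS : S.IsLinearCoxeterSystem)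
    {J : Set (Fin n)} (hJ : S.IsPositiveType J) {x y : Fin n → ℝ} (hx : ∀ i ∉ J, x i = 0)
    (hy : ∀ i ∉ J, y i = 0) (h : S.rootComb x = S.rootComb y) : x = y := by
  obtain ⟨u, hu, hAu⟩ := hJ.exists_blockCartan
  rw [← sub_eq_zero]
  have hxy : ∀ i ∉ J, (x - y) i = 0 := fun i hi => by simp [hx i hi, hy i hi]
  apply eq_zero_of_mulVec_eq_zero (hS.blockCartan_nonpos J) hu hAu
  funext i
  by_cases hi : i ∈ J
  · rw [blockCartan_mulVec_of_mem hxy hi, map_sub, h, sub_self]; rfl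
  · rw [blockCartan_mulVec_of_notMem _ hi, hxy i hi, mul_zero]; rfl

/-- B = D A_J is symmetric, and in root coordinates σ_i is x ↦ x - (A x)_i e_i, the B-orthogonal
reflection. The constants `k` make positive definiteness quantitative. -/
theorem IsLinearCoxeterSystem.exists_invariant_form (hS : S.IsLinearCoxeterSystem)
    {J : Set (Fin n)} (hJ : S.IsPositiveType J) :
    ∃ B : Matrix (Fin n) (Fin n) ℝ, ∃ k : Fin n → ℝ, (∀ i, 0 < k i) ∧
      (∀ x i, k i * x i ^ 2 ≤ x ⬝ᵥ B *ᵥ x) ∧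
      ∀ w ∈ S.parabolic J, ∃ T : (Fin n → ℝ) →ₗ[ℝ] (Fin n → ℝ),
        (∀ x, S.rootComb (T x) = w (S.rootComb x)) ∧
        ∀ x, (∀ i ∉ J, x i = 0) → (∀ i ∉ J, T x i = 0) ∧ T x ⬝ᵥ B *ᵥ T x = x ⬝ᵥ B *ᵥ x := by
  obtain ⟨u, hu, hAu⟩ := hJ.exists_blockCartan
  obtain ⟨d, hd, hsymm⟩ := exists_symmetrization (hS.blockCartan_nonpos J) (blockCartan_self J)
    (hS.one_le_blockCartan_mul J) hu Finset.univ (fun i _ => hAu i)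
  replace hsymm : ∀ i j, d i * S.blockCartan J i j = d j * S.blockCartan J j i :=
    fun i j => hsymm i (Finset.mem_univ _) j (Finset.mem_univ _)
  set B : Matrix (Fin n) (Fin n) ℝ := Matrix.of fun i j => d i * S.blockCartan J i j with hB
  have hBx : ∀ x i, (B *ᵥ x) i = d i * (S.blockCartan J *ᵥ x) i := fun x i => by
    simp only [hB, mulVec, dotProduct, of_apply, Finset.mul_sum, mul_assoc]
  have hBT : Bᵀ = B := by
    ext i j
    simp only [hB, transpose_apply, of_apply]
    exact (hsymm i j).symm
  have hk : ∀ i, 0 < d i * (S.blockCartan J *ᵥ u) i / u i := fun i =>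
    div_pos (mul_pos (hd i) (hAu i)) (hu i)
  refine ⟨B, fun i => d i * (S.blockCartan J *ᵥ u) i / u i, hk, fun x i => ?_, fun w hw => ?_⟩
  · have h1 := le_sum_mul_mul (hS.blockCartan_nonpos J) hu hd hsymm x
    have h2 : x ⬝ᵥ B *ᵥ x = ∑ i, ∑ j, d i * S.blockCartan J i j * (x i * x j) := by
      simp only [dotProduct, mulVec, Finset.mul_sum, hB, of_apply]
      exact Finset.sum_congr rfl fun i _ => Finset.sum_congr rfl fun j _ => by ring
    rw [h2]
    refine le_trans ?_ h1
    exact Finset.single_le_sum (f := fun i => d i * (S.blockCartan J *ᵥ u) i / u i * x i ^ 2)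
      (fun j _ => mul_nonneg (hk j).le (sq_nonneg _)) (Finset.mem_univ i)
  · refine parabolic_induction (J := J) (p := fun w => ∃ T : (Fin n → ℝ) →ₗ[ℝ] (Fin n → ℝ),
        (∀ x, S.rootComb (T x) = w (S.rootComb x)) ∧
        ∀ x, (∀ i ∉ J, x i = 0) → (∀ i ∉ J, T x i = 0) ∧ T x ⬝ᵥ B *ᵥ T x = x ⬝ᵥ B *ᵥ x)
      ⟨LinearMap.id, by simp, by simp⟩ ?_ hw
    rintro i hi w - ⟨T, hT, hTJ⟩
    let φ : (Fin n → ℝ) →ₗ[ℝ] ℝ := Dual.eval ℝ 𝔥 (S.h i) ∘ₗ S.rootComb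
    refine ⟨(LinearMap.id - LinearMap.single ℝ (fun _ => ℝ) i ∘ₗ φ) ∘ₗ T, fun x => ?_,
      fun x hx => ?_⟩
    · rw [LinearEquiv.mul_apply, ← hT, refl_apply]
      simp [φ, rootComb_single]
    · obtain ⟨h1, h2⟩ := hTJ x hx
      set y := T x with hy
      have hφ : φ y = (S.blockCartan J *ᵥ y) i := (blockCartan_mulVec_of_mem h1 hi).symm
      have hval : ((LinearMap.id - LinearMap.single ℝ (fun _ => ℝ) i ∘ₗ φ) ∘ₗ T) x =
          y - Pi.single i (φ y) := by
        simp [← hy]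
      rw [hval, ← h2]
      refine ⟨fun j hj => ?_, ?_⟩
      · have : j ≠ i := by rintro rfl; exact hj hi
        simp [this, h1 j hj]
      · have hs : y ⬝ᵥ B *ᵥ Pi.single i (φ y) = Pi.single i (φ y) ⬝ᵥ B *ᵥ y := by
          rw [dotProduct_mulVec, ← mulVec_transpose, hBT, dotProduct_comm]
        rw [mulVec_sub, sub_dotProduct, dotProduct_sub, dotProduct_sub, hs, single_dotProduct,
          single_dotProduct, hBx, ← hφ, mulVec_single]
        simp [hB, blockCartan_self]
        ring

theorem IsLinearCoxeterSystem.finite_parabolic (hS : S.IsLinearCoxeterSystem)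
    {J : Set (Fin n)} (hJ : S.IsPositiveType J) : Finite (S.parabolic J) := by
  obtain ⟨p, hp⟩ := hS.exists_mem_openFacet hJ
  obtain ⟨B, k, hk, hkB, hT⟩ := hS.exists_invariant_form hJ
  have hinj := fun {x y : Fin n → ℝ} => hS.rootComb_injOn hJ (x := x) (y := y)
  obtain ⟨u, -, hu0, hpos⟩ := hJ
  choose T hT hTJ using fun w : S.parabolic J => hT w w.2
  have hQc : Continuous fun x : Fin n → ℝ => x ⬝ᵥ B *ᵥ x := by
    simp only [dotProduct, mulVec]
    fun_prop
  -- Choice of radii: within `r₁` of u all points stay positive on J; a form value below `δ` forces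
  -- norm below `r₁`; norm below `r` forces form value below `δ`.
  have hO : ∀ᶠ y in 𝓝 (0 : Fin n → ℝ), ∀ i, i ∈ J → 0 < S.rootComb (u + y) (S.h i) := by
    rw [eventually_all]
    intro i
    by_cases hi : i ∈ J
    · have hc : Continuous fun y : Fin n → ℝ => S.rootComb (u + y) (S.h i) := by
        simp only [rootComb_apply_coroot, Pi.add_apply]
        fun_prop
      filter_upwards [hc.continuousAt.eventually_const_lt (by simpa using hpos i hi)] with y hy _
      exact hy
    · simp [hi]
  obtain ⟨r₁, hr₁, hO⟩ := Metric.eventually_nhds_iff.1 hO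
  have hδ : ∀ᶠ δ in 𝓝[>] (0 : ℝ), ∀ i, δ < k i * r₁ ^ 2 := by
    rw [eventually_all]
    intro i
    exact (eventually_lt_nhds (by have := hk i; positivity)).filter_mono nhdsWithin_le_nhds
  obtain ⟨δ, hδ, hδ0⟩ := (hδ.and self_mem_nhdsWithin).exists
  have hQ0 : ∀ᶠ y in 𝓝 (0 : Fin n → ℝ), y ⬝ᵥ B *ᵥ y < δ :=
    hQc.continuousAt.eventually_lt_const (by simpa using hδ0)
  obtain ⟨r, hr, hQ0⟩ := Metric.eventually_nhds_iff.1 hQ0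
  refine finite_of_separated_of_bounded (fun w => T w u)
    (C := ∑ i, √((u ⬝ᵥ B *ᵥ u) / k i)) (fun w => ?_) hr (fun w w' hww => ?_)
  · rw [pi_norm_le_iff_of_nonneg (Finset.sum_nonneg fun i _ => Real.sqrt_nonneg _)]
    intro i
    refine le_trans ?_ (Finset.single_le_sum (f := fun i => √((u ⬝ᵥ B *ᵥ u) / k i))
      (fun i _ => Real.sqrt_nonneg _) (Finset.mem_univ i))
    apply Real.le_sqrt_of_sq_le
    rw [Real.norm_eq_abs, sq_abs, le_div_iff₀ (hk i), ← (hTJ w u hu0).2, mul_comm]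
    exact hkB _ _
  -- By invariance `z` has the same form value as the difference of the two orbit points, so it is
  -- small and w'⁻¹ w u is still positive on J. Hence w'⁻¹ w = 1.
  · set z := T (w'⁻¹ * w) u - u with hz
    have hz0 : ∀ i ∉ J, z i = 0 := fun i hi => by
      simp [hz, hu0 i hi, (hTJ (w'⁻¹ * w) u hu0).1 i hi]
    have hyz : T w u - T w' u = T w' z := by
      rw [hz, map_sub]
      congr 1
      refine hinj (hTJ w u hu0).1 (hTJ w' _ (hTJ _ u hu0).1).1 ?_
      rw [hT, hT, hT, ← LinearEquiv.mul_apply, ← Subgroup.coe_mul, mul_inv_cancel_left]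
    have hQz : z ⬝ᵥ B *ᵥ z < δ := by
      rw [← (hTJ w' z hz0).2, ← hyz]
      exact hQ0 (by rwa [dist_zero_right])
    have hzr : dist z 0 < r₁ := by
      rw [dist_zero_right, pi_norm_lt_iff hr₁]
      intro i
      have h1 := (hkB z i).trans_lt (hQz.trans (hδ i))
      have h2 := lt_of_mul_lt_mul_left h1 (hk i).le
      exact abs_lt_of_sq_lt_sq h2 hr₁.le
    have hpos' := hO hzr
    rw [hz, add_sub_cancel, hT] at hpos'
    have h1 := hS.eq_one_of_pos hp (w'⁻¹ * w).2 hpos hpos'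
    have h2 : w'⁻¹ * w = 1 := Subtype.ext h1
    exact (inv_mul_eq_one.1 h2).symm

end FiniteParabolic

end ReflectionDatum

namespace ReflectionDatum

/-! ### Connected components and the finite part -/

section Components

variable {𝔥 : Type*} [AddCommGroup 𝔥] [Module ℝ 𝔥] {n : ℕ} {S : ReflectionDatum 𝔥 n}
  {J K : Set (Fin n)}

theorem exists_isComponent_mem {i : Fin n} (hi : i ∈ J) : ∃ K, S.IsComponent J K ∧ i ∈ K :=
  ⟨_, ⟨(S.diagram.induce J).connectedComponentMk ⟨i, hi⟩, rfl⟩, ⟨i, hi⟩,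
    SimpleGraph.ConnectedComponent.connectedComponentMk_mem, rfl⟩

theorem IsComponent.subset (hK : S.IsComponent J K) : K ⊆ J := by
  obtain ⟨c, rfl⟩ := hK
  rintro _ ⟨x, -, rfl⟩
  exact x.2

theorem IsComponent.mem_of_cartan_ne_zero (hK : S.IsComponent J K) {i j : Fin n} (hi : i ∈ K)
    (hj : j ∈ J) (hij : S.cartan i j ≠ 0) : j ∈ K := by
  by_cases h : i = j
  · exact h ▸ hi
  obtain ⟨c, rfl⟩ := hK
  obtain ⟨x, hx, rfl⟩ := hi
  have hadj : (S.diagram.induce J).Adj ⟨j, hj⟩ x :=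
    ((SimpleGraph.fromRel_adj _ _ _).2 ⟨Ne.symm h, Or.inr hij⟩ : S.diagram.Adj j x)
  refine ⟨⟨j, hj⟩, ?_, rfl⟩
  rw [SimpleGraph.ConnectedComponent.mem_supp_iff] at hx ⊢
  rw [← hx]
  exact SimpleGraph.ConnectedComponent.sound hadj.reachable

theorem IsLinearCoxeterSystem.eq_univ_of_isComponent [FiniteDimensional ℝ 𝔥]
    (hS : S.IsLinearCoxeterSystem) (hK : S.IsComponent J K) (Z : Set K) (hZ : Z.Nonempty)
    (hclosed : ∀ i ∈ Z, ∀ j : K, S.cartan i j ≠ 0 → j ∈ Z) : Z = Set.univ := by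
  obtain ⟨z, hz⟩ := hZ
  obtain ⟨c, rfl⟩ := hK
  have key : ∀ x y : J, (S.diagram.induce J).Reachable x y →
      ∀ hx : (x : Fin n) ∈ Subtype.val '' c.supp, (⟨x, hx⟩ : ↥(Subtype.val '' c.supp)) ∈ Z →
      ∀ hy : (y : Fin n) ∈ Subtype.val '' c.supp, (⟨y, hy⟩ : ↥(Subtype.val '' c.supp)) ∈ Z := by
    intro x y hxy
    obtain ⟨p⟩ := hxy
    induction p with
    | nil => intro _ h _; exact h
    | @cons a b d hab p ih =>
      intro ha haZ hd
      obtain ⟨a', ha', haa⟩ := ha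
      have hb : (b : Fin n) ∈ Subtype.val '' c.supp := by
        refine ⟨b, ?_, rfl⟩
        have : a' = a := Subtype.ext haa
        rw [SimpleGraph.ConnectedComponent.mem_supp_iff] at ha' ⊢
        rw [← ha', this]
        exact (SimpleGraph.ConnectedComponent.sound hab.reachable).symm
      refine ih hb (hclosed _ haZ _ ?_) hd
      have hab' : S.diagram.Adj a b := hab
      rw [diagram, SimpleGraph.fromRel_adj] at hab'
      exact hab'.2.elim id fun h => hS.cartan_ne_zero_symm h
  refine Set.eq_univ_of_forall fun y => ?_
  obtain ⟨z', hz', hzz⟩ := z.2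
  obtain ⟨y', hy', hyy⟩ := y.2
  have hr : (S.diagram.induce J).Reachable z' y' := by
    rw [SimpleGraph.ConnectedComponent.mem_supp_iff] at hz' hy'
    exact SimpleGraph.ConnectedComponent.exact (hz'.trans hy'.symm)
  have e : (⟨y', hyy ▸ y.2⟩ : ↥(Subtype.val '' c.supp)) = y := Subtype.ext hyy
  exact Set.mem_of_eq_of_mem e.symm (key z' y' hr (hzz ▸ z.2) (by convert hz) _)

theorem sum_coe_eq_sum [Fintype K] {f : Fin n → ℝ} (hf : ∀ i ∉ K, f i = 0) :
    ∑ j : K, f j = ∑ j, f j := by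
  refine Finset.sum_of_injOn Subtype.val Subtype.val_injective.injOn (fun _ _ => by simp) ?_
    (fun _ _ => rfl)
  intro i _ hi
  exact hf i fun hiK => hi ⟨⟨i, hiK⟩, by simp, rfl⟩

theorem submatrix_mulVec_eq [Fintype K] {x : Fin n → ℝ} (hx : ∀ i ∉ K, x i = 0) (i : K) :
    (S.cartan.submatrix (Subtype.val : K → Fin n) Subtype.val).mulVec (fun j : K => x j) i =
      S.rootComb x (S.h i) := by
  rw [rootComb_apply_coroot,
    ← sum_coe_eq_sum (K := K) (f := fun j => S.cartan i j * x j) fun j hj => by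
      rw [hx j hj, mul_zero]]
  rfl

theorem IsFiniteType.isPositiveType (hK : S.IsFiniteType K) : S.IsPositiveType K := by
  classical
  obtain ⟨-, ⟨u, hu, hAu⟩, -⟩ := hK
  have hext : ∀ i : K, (fun i => if h : i ∈ K then u ⟨i, h⟩ else 0 : Fin n → ℝ) i = u i :=
    fun i => by simp
  refine ⟨fun i => if h : i ∈ K then u ⟨i, h⟩ else 0, fun i hi => ?_, fun i hi => ?_,
    fun i hi => ?_⟩
  · simpa [hi] using hu ⟨i, hi⟩
  · simp [hi]
  · have := submatrix_mulVec_eq (S := S) (K := K)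
      (x := fun i => if h : i ∈ K then u ⟨i, h⟩ else 0) (fun i hi => by simp [hi]) ⟨i, hi⟩
    rw [← this]
    simp only [hext]
    convert hAu ⟨i, hi⟩

theorem IsLinearCoxeterSystem.rootComb_apply_eq_zero [FiniteDimensional ℝ 𝔥]
    (hS : S.IsLinearCoxeterSystem) (hK : S.IsComponent J K) {x : Fin n → ℝ}
    (hx : ∀ i ∉ K, x i = 0) {i : Fin n} (hiJ : i ∈ J) (hiK : i ∉ K) :
    S.rootComb x (S.h i) = 0 := by
  rw [rootComb_apply_coroot]
  refine Finset.sum_eq_zero fun j _ => ?_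
  by_cases hj : j ∈ K
  · have : S.cartan i j = 0 := by
      by_contra h
      exact hiK (hK.mem_of_cartan_ne_zero hj hiJ (hS.cartan_ne_zero_symm h))
    rw [this, zero_mul]
  · rw [hx j hj, mul_zero]

/-- Positive vectors of the components add up, because roots of one component vanish on the coroots
of the others. -/
theorem IsLinearCoxeterSystem.isPositiveType_of_finitePart [FiniteDimensional ℝ 𝔥]
    (hS : S.IsLinearCoxeterSystem) (hJ : S.finitePart J = J) : S.IsPositiveType J := by
  classical
  have hex : ∀ K, ∃ u : Fin n → ℝ, S.IsComponent J K ∧ S.IsFiniteType K →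
      (∀ i ∈ K, 0 < u i) ∧ (∀ i ∉ K, u i = 0) ∧ ∀ i ∈ K, 0 < S.rootComb u (S.h i) := by
    intro K
    by_cases h : S.IsComponent J K ∧ S.IsFiniteType K
    · obtain ⟨u, hu⟩ := h.2.isPositiveType
      exact ⟨u, fun _ => hu⟩
    · exact ⟨0, fun h' => absurd h' h⟩
  choose u hu using hex
  let s : Finset (Set (Fin n)) :=
    Finset.univ.filter fun K => S.IsComponent J K ∧ S.IsFiniteType K
  have hmem : ∀ i ∈ J, ∃ K ∈ s, i ∈ K := fun i hi => by
    rw [← hJ] at hi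
    obtain ⟨K, hK, hiK⟩ := hi
    exact ⟨K, by simpa [s] using hK, hiK⟩
  have hs : ∀ K ∈ s, S.IsComponent J K ∧ S.IsFiniteType K := fun K hK => by simpa [s] using hK
  refine ⟨∑ K ∈ s, u K, fun i hi => ?_, fun i hi => ?_, fun i hi => ?_⟩
  · rw [Finset.sum_apply]
    obtain ⟨K, hK, hiK⟩ := hmem i hi
    refine Finset.sum_pos' (fun K' hK' => ?_) ⟨K, hK, (hu K (hs K hK)).1 i hiK⟩
    by_cases h : i ∈ K'
    · exact ((hu K' (hs K' hK')).1 i h).le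
    · exact ((hu K' (hs K' hK')).2.1 i h).ge
  · rw [Finset.sum_apply]
    exact Finset.sum_eq_zero fun K hK =>
      (hu K (hs K hK)).2.1 i fun h => hi ((hs K hK).1.subset h)
  · rw [map_sum, LinearMap.sum_apply]
    obtain ⟨K, hK, hiK⟩ := hmem i hi
    refine Finset.sum_pos' (fun K' hK' => ?_) ⟨K, hK, (hu K (hs K hK)).2.2 i hiK⟩
    by_cases h : i ∈ K'
    · exact ((hu K' (hs K' hK')).2.2 i h).le
    · exact (hS.rootComb_apply_eq_zero (hs K' hK').1 (hu K' (hs K' hK')).2.1 hi h).ge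

theorem exists_rootComb_of_mem_parabolic {w : Dual ℝ 𝔥 ≃ₗ[ℝ] Dual ℝ 𝔥} (hw : w ∈ S.parabolic K)
    {x : Fin n → ℝ} (hx : ∀ i ∉ K, x i = 0) :
    ∃ y : Fin n → ℝ, (∀ i ∉ K, y i = 0) ∧ w (S.rootComb x) = S.rootComb y := by
  refine parabolic_induction (J := K) (p := fun w => ∃ y : Fin n → ℝ, (∀ i ∉ K, y i = 0) ∧
    w (S.rootComb x) = S.rootComb y) ⟨x, hx, rfl⟩ ?_ hw
  rintro i hi w - ⟨y, hy, hwy⟩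
  refine ⟨y - Pi.single i (S.rootComb y (S.h i)), fun j hj => ?_, ?_⟩
  · have : j ≠ i := by rintro rfl; exact hj hi
    simp [this, hy j hj]
  · rw [LinearEquiv.mul_apply, hwy, refl_apply, map_sub, rootComb_single]

end Components

/-! ### Faces of Y meeting the closed chamber -/

section CrossSection

variable {𝔥 : Type*} [AddCommGroup 𝔥] [Module ℝ 𝔥] {n : ℕ} {S : ReflectionDatum 𝔥 n}
  {Y R : PointedCone ℝ (Dual ℝ 𝔥)}

theorem root_ne_zero (i : Fin n) : S.α i ≠ 0 := fun h => by
  have := S.pairing_self i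
  rw [h, LinearMap.zero_apply] at this
  norm_num at this

theorem mem_lowerType_iff {i : Fin n} : i ∈ S.lowerType R ↔ ∀ l ∈ R, l (S.h i) = 0 := by
  refine forall₂_congr fun l _ => ?_
  rw [refl_apply, sub_eq_self, smul_eq_zero, or_iff_left (root_ne_zero i)]

theorem refl_mem_of_mem_typeMap {i : Fin n} (hi : i ∈ S.typeMap R) {l : Dual ℝ 𝔥} (hl : l ∈ R) :
    S.refl i l ∈ R := by
  have : S.refl i l ∈ S.refl i '' (R : Set (Dual ℝ 𝔥)) := ⟨l, hl, rfl⟩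
  rwa [show S.refl i '' (R : Set (Dual ℝ 𝔥)) = R from hi] at this

/-- σ_i fixes x = (x - εy) + εy, so x is also the sum of the σ_i-images of both terms. These lie in
Y, and the face property puts σ_i y in R. -/
theorem mem_typeMap_of_apply_eq_zero [FiniteDimensional ℝ 𝔥] (hY : S.IsInvariantSubcone Y)
    (hRY : R.IsFaceOf Y) {x : Dual ℝ 𝔥} (hx : x ∈ relInt (R : Set (Dual ℝ 𝔥))) {i : Fin n}
    (hxi : x (S.h i) = 0) : i ∈ S.typeMap R := by
  have hmaps : ∀ y ∈ R, S.refl i y ∈ R := by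
    intro y hy
    obtain ⟨hxR, H⟩ := mem_relInt_pointedCone.1 hx
    obtain ⟨ε, hε, h⟩ := H y hy
    refine hRY.mem_of_smul_add_mem (hY.invariant _ (refl_mem_weyl i) _ (hRY.le hy))
      (hY.invariant _ (refl_mem_weyl i) _ (hRY.le h)) hε ?_
    rw [← map_smul, ← map_add, add_sub_cancel, refl_apply, hxi, zero_smul, sub_zero]
    exact hxR
  refine Set.Subset.antisymm ?_ fun y hy => ⟨S.refl i y, hmaps y hy, refl_refl i y⟩
  rintro _ ⟨y, hy, rfl⟩
  exact hmaps y hy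

theorem root_mem_span {i : Fin n} (hi : i ∈ S.upperType R) :
    S.α i ∈ Submodule.span ℝ (R : Set (Dual ℝ 𝔥)) := by
  obtain ⟨hi, hni⟩ := hi
  rw [mem_lowerType_iff] at hni
  push Not at hni
  obtain ⟨l, hl, hne⟩ := hni
  have : S.α i = (l (S.h i))⁻¹ • (l - S.refl i l) := by
    rw [refl_apply, sub_sub_cancel, smul_smul, inv_mul_cancel₀ hne, one_smul]
  rw [this]
  exact Submodule.smul_mem _ _ (Submodule.sub_mem _ (Submodule.subset_span hl)
    (Submodule.subset_span (refl_mem_of_mem_typeMap hi hl)))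

/-- h_i vanishes on span R, which contains α_j. So changing a point by roots of υ^* never disturbs
the equations of υ_*. -/
theorem cartan_eq_zero_of_mem_lowerType {i j : Fin n} (hi : i ∈ S.lowerType R)
    (hj : j ∈ S.upperType R) : S.cartan i j = 0 := by
  have hle : Submodule.span ℝ (R : Set (Dual ℝ 𝔥)) ≤ LinearMap.ker (Dual.eval ℝ 𝔥 (S.h i)) := by
    rw [Submodule.span_le]
    exact fun l hl => mem_lowerType_iff.1 hi l hl
  exact hle (root_mem_span hj)

theorem rootComb_mem_span {J : Set (Fin n)} (hJ : J ⊆ S.upperType R) {x : Fin n → ℝ}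
    (hx : ∀ i ∉ J, x i = 0) : S.rootComb x ∈ Submodule.span ℝ (R : Set (Dual ℝ 𝔥)) := by
  rw [rootComb_apply]
  refine Submodule.sum_mem _ fun j _ => ?_
  by_cases hj : j ∈ J
  · exact Submodule.smul_mem _ _ (root_mem_span (hJ hj))
  · rw [hx j hj, zero_smul]; exact Submodule.zero_mem _

theorem rootComb_apply_of_mem_lowerType {J : Set (Fin n)} (hJ : J ⊆ S.upperType R)
    {x : Fin n → ℝ} (hx : ∀ i ∉ J, x i = 0) {i : Fin n} (hi : i ∈ S.lowerType R) :
    S.rootComb x (S.h i) = 0 := by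
  rw [rootComb_apply_coroot]
  refine Finset.sum_eq_zero fun j _ => ?_
  by_cases hj : j ∈ J
  · rw [cartan_eq_zero_of_mem_lowerType hi (hJ hj), zero_mul]
  · rw [hx j hj, mul_zero]

variable [FiniteDimensional ℝ 𝔥]

/-- p plus a small multiple of the combination stays in R, hence in the Tits cone, where W_K can
make it dominant on K. As p is W_K-fixed and zero on K, it drops out. -/
theorem IsLinearCoxeterSystem.exists_parabolic_rootComb_nonneg (hS : S.IsLinearCoxeterSystem)
    (hY : S.IsInvariantSubcone Y) (hRY : R ≤ Y) {K : Set (Fin n)}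
    (hKR : K ⊆ S.upperType R) {p : Dual ℝ 𝔥} (hp : p ∈ relInt (R : Set (Dual ℝ 𝔥)))
    (hpK : ∀ i ∈ K, p (S.h i) = 0) {x : Fin n → ℝ} (hx : ∀ i ∉ K, x i = 0) :
    ∃ w ∈ S.parabolic K, ∀ i ∈ K, 0 ≤ w (S.rootComb x) (S.h i) := by
  obtain ⟨ε, h, hε⟩ := ((eventually_add_smul_mem_relInt hp (rootComb_mem_span hKR hx)).and
    self_mem_nhdsWithin).exists
  obtain ⟨w, hw, hpos⟩ := hS.exists_parabolic_apply_nonneg K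
    (hY.subset_titsCone (hRY (relInt_subset_pointedCone h)))
  refine ⟨w, hw, fun i hi => ?_⟩
  have := hpos i hi
  rw [map_add, map_smul, parabolic_apply_eq_self hw hpK, LinearMap.add_apply, hpK i hi, zero_add,
    LinearMap.smul_apply, smul_eq_mul] at this
  exact nonneg_of_mul_nonneg_right this hε

/-- The nonnegative vector for Vinberg's criterion is the coefficient vector of ε(x - v x), where x
and v(-x) are both dominant on K. -/
theorem IsLinearCoxeterSystem.isFiniteType_of_isComponent (hS : S.IsLinearCoxeterSystem)
    (hY : S.IsInvariantSubcone Y) (hRY : R ≤ Y) {J K : Set (Fin n)} (hJ : J ⊆ S.upperType R)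
    {p : Dual ℝ 𝔥} (hp : p ∈ relInt (R : Set (Dual ℝ 𝔥)))
    (hpJ : p ∈ S.openFacet (S.lowerType R ∪ J)) (hK : S.IsComponent J K) : S.IsFiniteType K := by
  have hKJ := hK.subset
  have hpK : ∀ i ∈ K, p (S.h i) = 0 := fun i hi => hpJ.1 i (Or.inr (hKJ hi))
  have hdom := fun {x : Fin n → ℝ} => hS.exists_parabolic_rootComb_nonneg hY hRY
    (hKJ.trans hJ) hp hpK (x := x)
  obtain ⟨k, hk⟩ : K.Nonempty := by
    obtain ⟨c, rfl⟩ := hK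
    exact c.nonempty_supp.image _
  have hsingle : ∀ i ∉ K, (Pi.single k 1 : Fin n → ℝ) i = 0 := fun i hi => by
    have : i ≠ k := by rintro rfl; exact hi hk
    simp [this]
  -- a dominant nonzero point in the span of the roots of `K`
  obtain ⟨w, hw, hwpos⟩ := hdom hsingle
  obtain ⟨x, hx, hwx⟩ := exists_rootComb_of_mem_parabolic hw hsingle
  rw [hwx] at hwpos
  -- Otherwise W_K would fix the point, which would then equal α_k, although α_k(h_k) = 2.
  have hne : ∃ i ∈ K, 0 < S.rootComb x (S.h i) := by
    by_contra! hcon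
    have h0 : ∀ i ∈ K, S.rootComb x (S.h i) = 0 := fun i hi =>
      le_antisymm (hcon i hi) (hwpos i hi)
    have h1 := parabolic_apply_eq_self (inv_mem hw) h0
    rw [← hwx, ← LinearEquiv.mul_apply, inv_mul_cancel, LinearEquiv.coe_one, id, hwx] at h1
    have h2 := h0 k hk
    rw [← h1, rootComb_single, one_smul, S.pairing_self] at h2
    norm_num at h2
  have hnn : ∀ i ∈ S.lowerType R ∪ J, 0 ≤ S.rootComb x (S.h i) := by
    rintro i (hi | hi)
    · exact (rootComb_apply_of_mem_lowerType (hKJ.trans hJ) hx hi).ge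
    · by_cases hiK : i ∈ K
      · exact hwpos i hiK
      · exact (hS.rootComb_apply_eq_zero hK hx hi hiK).ge
  obtain ⟨v, hv, hvpos⟩ := hdom (x := -x) (fun i hi => by simp [hx i hi])
  obtain ⟨ε, hC, hε⟩ := ((eventually_add_smul_mem_closedChamber hpJ hnn).and
    self_mem_nhdsWithin).exists
  obtain ⟨c, hc, hcK, hvc⟩ := hS.exists_sub_eq_sum hv hC
  rw [map_add, parabolic_apply_eq_self hv hpK, map_smul, add_sub_assoc, add_right_inj,
    ← rootComb_apply] at hvc
  have hval : ∀ i, S.rootComb c (S.h i) =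
      ε * (S.rootComb x (S.h i) + v (S.rootComb (-x)) (S.h i)) := by
    intro i
    have h1 : S.rootComb c = ε • S.rootComb x - ε • v (S.rootComb x) := by
      rw [hvc]; abel
    rw [h1, map_neg, map_neg]
    simp only [LinearMap.sub_apply, LinearMap.smul_apply, LinearMap.neg_apply, smul_eq_mul]
    ring
  have hε' : 0 < ε := hε
  classical
  obtain ⟨i, hi, hipos⟩ := hne
  refine isFiniteTypeMatrix_of_connected (fun i j hij => ?_) (hS.eq_univ_of_isComponent hK)
    (u := fun j : K => c j) (fun j => hc j) (fun j => ?_) (k := ⟨i, hi⟩) ?_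
  · exact hS.cartan_nonpos fun h => hij (Subtype.ext h)
  · rw [submatrix_mulVec_eq hcK, hval]
    exact mul_nonneg hε'.le (add_nonneg (hwpos _ j.2) (hvpos _ j.2))
  · rw [submatrix_mulVec_eq hcK, hval]
    exact mul_pos hε' (add_pos_of_pos_of_nonneg hipos (hvpos _ hi))

theorem IsLinearCoxeterSystem.exists_finiteIndices (hS : S.IsLinearCoxeterSystem)
    (hY : S.IsInvariantSubcone Y) (hRY : R.IsFaceOf Y) {p : Dual ℝ 𝔥}
    (hp : p ∈ relInt (R : Set (Dual ℝ 𝔥))) (hpC : p ∈ S.closedChamber) :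
    ∃ J ∈ S.finiteIndices R, p ∈ S.openFacet (S.lowerType R ∪ J) := by
  set J : Set (Fin n) := {i | p (S.h i) = 0} \ S.lowerType R with hJ
  have hJR : J ⊆ S.upperType R := fun i hi =>
    ⟨mem_typeMap_of_apply_eq_zero hY hRY hp hi.1, hi.2⟩
  have hpJ : p ∈ S.openFacet (S.lowerType R ∪ J) := by
    refine ⟨?_, fun i hi => ?_⟩
    · rintro i (hi | hi)
      · exact mem_lowerType_iff.1 hi p (relInt_subset_pointedCone hp)
      · exact hi.1
    · refine lt_of_le_of_ne (hpC i) fun h => hi ?_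
      by_cases hl : i ∈ S.lowerType R
      · exact Or.inl hl
      · exact Or.inr ⟨h.symm, hl⟩
  refine ⟨J, ⟨hJR, Set.Subset.antisymm ?_ fun i hi => ?_⟩, hpJ⟩
  · rintro i ⟨K, hK, hiK⟩
    exact hK.1.subset hiK
  · obtain ⟨K, hK, hiK⟩ := exists_isComponent_mem (S := S) hi
    exact ⟨K, ⟨hK, hS.isFiniteType_of_isComponent hY hRY.le hJR hp hpJ hK⟩, hiK⟩

end CrossSection

end ReflectionDatum

namespace ReflectionDatum

/-! ### Averaging over a finite parabolic subgroup -/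

section Projector

variable {𝔥 : Type*} [AddCommGroup 𝔥] [Module ℝ 𝔥] {n : ℕ} {S : ReflectionDatum 𝔥 n}
  {J : Set (Fin n)}

theorem mid_apply [Fintype (S.parabolic J)] (l : Dual ℝ 𝔥) :
    S.mid J l = (Nat.card (S.parabolic J) : ℝ)⁻¹ •
      ∑ σ : S.parabolic J, (σ : Dual ℝ 𝔥 ≃ₗ[ℝ] Dual ℝ 𝔥) l := by
  rw [mid, finsum_eq_sum_of_fintype, LinearMap.smul_apply, LinearMap.sum_apply]
  rfl

theorem mid_apply_eq_self [Finite (S.parabolic J)] {l : Dual ℝ 𝔥}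
    (hl : ∀ i ∈ J, l (S.h i) = 0) : S.mid J l = l := by
  have := Fintype.ofFinite (S.parabolic J)
  rw [mid_apply, Finset.sum_congr rfl fun σ _ => parabolic_apply_eq_self σ.2 hl,
    Finset.sum_const, Finset.card_univ, ← Nat.card_eq_fintype_card, ← Nat.cast_smul_eq_nsmul ℝ,
    smul_smul, inv_mul_cancel₀ (Nat.cast_ne_zero.2 Nat.card_pos.ne'), one_smul]

theorem mid_refl [Finite (S.parabolic J)] {i : Fin n} (hi : i ∈ J) (l : Dual ℝ 𝔥) :
    S.mid J (S.refl i l) = S.mid J l := by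
  have := Fintype.ofFinite (S.parabolic J)
  rw [mid_apply, mid_apply]
  congr 1
  exact Fintype.sum_equiv (Equiv.mulRight (⟨S.refl i, refl_mem_parabolic hi⟩ : S.parabolic J))
    _ _ fun σ => rfl

theorem refl_mid [Finite (S.parabolic J)] {i : Fin n} (hi : i ∈ J) (l : Dual ℝ 𝔥) :
    S.refl i (S.mid J l) = S.mid J l := by
  have := Fintype.ofFinite (S.parabolic J)
  rw [mid_apply, map_smul, map_sum]
  congr 1
  exact Fintype.sum_equiv (Equiv.mulLeft (⟨S.refl i, refl_mem_parabolic hi⟩ : S.parabolic J))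
    _ _ fun σ => rfl

theorem mid_apply_coroot [Finite (S.parabolic J)] {i : Fin n} (hi : i ∈ J) (l : Dual ℝ 𝔥) :
    S.mid J l (S.h i) = 0 := by
  have := refl_apply_coroot_self (S := S) i (S.mid J l)
  rw [refl_mid hi] at this
  linarith

theorem mid_rootComb [Finite (S.parabolic J)] {x : Fin n → ℝ} (hx : ∀ i ∉ J, x i = 0) :
    S.mid J (S.rootComb x) = 0 := by
  rw [rootComb_apply, map_sum]
  refine Finset.sum_eq_zero fun i _ => ?_
  by_cases hi : i ∈ J
  · have h1 := mid_refl (S := S) hi (S.α i)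
    have h2 : S.refl i (S.α i) = - S.α i := by
      rw [refl_apply, S.pairing_self]; module
    rw [h2, map_neg] at h1
    have h3 : (2 : ℝ) • S.mid J (S.α i) = 0 := by
      rw [two_smul]
      nth_rewrite 1 [← h1]
      exact neg_add_cancel _
    rw [map_smul, (smul_eq_zero.1 h3).resolve_left two_ne_zero, smul_zero]
  · rw [hx i hi, zero_smul, map_zero]

end Projector

/-! ### Strata of the relative interior -/

section Main

variable {𝔥 : Type*} [AddCommGroup 𝔥] [Module ℝ 𝔥] {n : ℕ} {S : ReflectionDatum 𝔥 n}
  {Y R : PointedCone ℝ (Dual ℝ 𝔥)} {J : Set (Fin n)}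

theorem openFacet_subset_closedChamber : S.openFacet J ⊆ S.closedChamber := fun l hl i => by
  by_cases hi : i ∈ J
  · exact (hl.1 i hi).ge
  · exact (hl.2 i hi).le

theorem inter_closedFacet_lowerType :
    (R : Set (Dual ℝ 𝔥)) ∩ S.closedFacet (S.lowerType R) =
      (R : Set (Dual ℝ 𝔥)) ∩ S.closedChamber := by
  ext l
  refine and_congr_right fun hl => ⟨fun h i => ?_, fun h => ⟨fun i hi => ?_, fun i _ => h i⟩⟩
  · by_cases hi : i ∈ S.lowerType R
    · exact (h.1 i hi).ge
    · exact h.2 i hi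
  · exact mem_lowerType_iff.1 hi l hl

theorem pairwiseDisjoint_inter_openFacet (s : Set (Dual ℝ 𝔥)) :
    (S.finiteIndices R).PairwiseDisjoint
      (fun J => s ∩ S.openFacet (S.lowerType R ∪ J)) := by
  have key : ∀ J ∈ S.finiteIndices R, ∀ l ∈ S.openFacet (S.lowerType R ∪ J),
      J = {i | l (S.h i) = 0} \ S.lowerType R := by
    intro J hJ l hl
    ext i
    refine ⟨fun hi => ⟨hl.1 i (Or.inr hi), (hJ.1 hi).2⟩, fun hi => ?_⟩
    by_contra hn
    exact (hl.2 i fun h => h.elim hi.2 hn).ne' hi.1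
  intro J hJ J' hJ' hne
  refine Set.disjoint_left.2 fun l hl hl' => hne ?_
  rw [key J hJ l hl.2, key J' hJ' l hl'.2]

variable [FiniteDimensional ℝ 𝔥]

/-- A small positive combination of J-roots lifts p off the walls of J. It lies in span R, so the
point stays in ri(R). -/
theorem IsLinearCoxeterSystem.exists_add_smul_rootComb (hS : S.IsLinearCoxeterSystem)
    (hJ : J ∈ S.finiteIndices R) {p : Dual ℝ 𝔥} (hp : p ∈ relInt (R : Set (Dual ℝ 𝔥)))
    (hpJ : p ∈ S.openFacet (S.lowerType R ∪ J)) :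
    ∃ x : Fin n → ℝ, (∀ i ∉ J, x i = 0) ∧
      p + S.rootComb x ∈ relInt (R : Set (Dual ℝ 𝔥)) ∩ S.openFacet (S.lowerType R) := by
  obtain ⟨u, -, hu0, hupos⟩ := hS.isPositiveType_of_finitePart hJ.2
  have hev : ∀ᶠ ε in 𝓝[>] (0 : ℝ), ∀ i, i ∉ S.lowerType R →
      0 < (p + ε • S.rootComb u) (S.h i) := by
    rw [eventually_all]
    intro i
    by_cases hi : i ∈ J
    · filter_upwards [self_mem_nhdsWithin] with ε hε _
      simpa [hpJ.1 i (Or.inr hi)] using mul_pos hε (hupos i hi)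
    · by_cases hil : i ∈ S.lowerType R
      · simp [hil]
      · filter_upwards [eventually_pos_add_mul (hpJ.2 i fun h => h.elim hil hi)
          (S.rootComb u (S.h i))] with ε hε _
        simpa using hε
  obtain ⟨ε, h1, h2⟩ := (hev.and (eventually_add_smul_mem_relInt hp
    (rootComb_mem_span hJ.1 hu0))).exists
  refine ⟨ε • u, fun i hi => by simp [hu0 i hi], ?_⟩
  rw [map_smul]
  exact ⟨h2, fun i hi => mem_lowerType_iff.1 hi _ (relInt_subset_pointedCone h2), h1⟩

theorem IsLinearCoxeterSystem.mid_mem (hS : S.IsLinearCoxeterSystem) (hJ : J ∈ S.finiteIndices R)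
    [Finite (S.parabolic J)] {p : Dual ℝ 𝔥} (hp : p ∈ relInt (R : Set (Dual ℝ 𝔥)))
    (hpl : p ∈ S.openFacet (S.lowerType R)) :
    S.mid J p ∈ relInt (R : Set (Dual ℝ 𝔥)) ∩ S.openFacet (S.lowerType R ∪ J) := by
  have := Fintype.ofFinite (S.parabolic J)
  have hcard : 0 < (Nat.card (S.parabolic J) : ℝ)⁻¹ := inv_pos.2 (Nat.cast_pos.2 Nat.card_pos)
  have hri : ∀ σ ∈ S.parabolic J, σ p ∈ relInt (R : Set (Dual ℝ 𝔥)) := fun σ hσ =>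
    parabolic_induction (J := J) (p := fun σ => σ p ∈ relInt (R : Set (Dual ℝ 𝔥))) hp
      (fun i hi w _ hw => map_mem_relInt (hJ.1 hi).1 hw) hσ
  have hmid : S.mid J p ∈ relInt (R : Set (Dual ℝ 𝔥)) := by
    rw [mid_apply]
    exact smul_mem_relInt (sum_mem_relInt
      (Finset.univ_nonempty (α := S.parabolic J)) fun σ _ => hri σ σ.2) hcard
  refine ⟨hmid, ?_, fun i hi => ?_⟩
  · rintro i (hi | hi)
    · exact mem_lowerType_iff.1 hi _ (relInt_subset_pointedCone hmid)
    · exact mid_apply_coroot hi p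
  · rw [mid_apply, LinearMap.smul_apply, LinearMap.sum_apply]
    refine smul_pos hcard (Finset.sum_pos (fun σ _ => ?_) Finset.univ_nonempty)
    obtain ⟨c, hc, hcJ, heq⟩ := hS.exists_sub_eq_sum σ.2 (openFacet_subset_closedChamber hpl)
    -- Here i ∉ J, so only off-diagonal Cartan entries occur: no element of W_J lowers the value at
    -- h_i.
    have h1 : S.rootComb c (S.h i) ≤ 0 := by
      rw [rootComb_apply_coroot]
      refine Finset.sum_nonpos fun j _ => ?_
      by_cases hj : j ∈ J
      · have hij : i ≠ j := by rintro rfl; exact hi (Or.inr hj)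
        exact mul_nonpos_of_nonpos_of_nonneg (hS.cartan_nonpos hij) (hc j)
      · rw [hcJ j hj, mul_zero]
    have h2 := hpl.2 i fun h => hi (Or.inl h)
    rw [heq, ← rootComb_apply, LinearMap.sub_apply]
    linarith

theorem IsLinearCoxeterSystem.mid_image (hS : S.IsLinearCoxeterSystem)
    (hJ : J ∈ S.finiteIndices R) [Finite (S.parabolic J)] :
    S.mid J '' (relInt (R : Set (Dual ℝ 𝔥)) ∩ S.openFacet (S.lowerType R)) =
      relInt (R : Set (Dual ℝ 𝔥)) ∩ S.openFacet (S.lowerType R ∪ J) := by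
  refine Set.Subset.antisymm ?_ fun p hp => ?_
  · rintro _ ⟨p, hp, rfl⟩
    exact hS.mid_mem hJ hp.1 hp.2
  · obtain ⟨x, hx, h⟩ := hS.exists_add_smul_rootComb hJ hp.1 hp.2
    refine ⟨_, h, ?_⟩
    rw [map_add, mid_rootComb hx, add_zero, mid_apply_eq_self fun i hi => hp.2.1 i (Or.inr hi)]

/-- One point p of ri(R) ∩ F_{υ_*} suffices: a relatively interior x of R ∩ C̄ is εp plus an element
of R ∩ C̄, so it inherits both properties of p. -/
theorem relInt_inter_closedChamber
    (hne : (relInt (R : Set (Dual ℝ 𝔥)) ∩ S.openFacet (S.lowerType R)).Nonempty) :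
    relInt ((R : Set (Dual ℝ 𝔥)) ∩ S.closedChamber) =
      relInt (R : Set (Dual ℝ 𝔥)) ∩ S.openFacet (S.lowerType R) := by
  change relInt ((R ⊓ S.closedChamber : PointedCone ℝ (Dual ℝ 𝔥)) : Set (Dual ℝ 𝔥)) = _
  refine Set.Subset.antisymm (fun x hx => ?_) fun x hx => ?_
  · obtain ⟨p, hp, hpl⟩ := hne
    obtain ⟨-, H⟩ := mem_relInt_pointedCone.1 hx
    obtain ⟨ε, hε, h⟩ := H p ⟨relInt_subset_pointedCone hp, openFacet_subset_closedChamber hpl⟩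
    have hxe : x = ε • p + (x - ε • p) := by abel
    have hxR : x ∈ relInt (R : Set (Dual ℝ 𝔥)) := by
      rw [hxe]
      exact add_mem_relInt (smul_mem_relInt hp hε) h.1
    refine ⟨hxR, fun i hi => mem_lowerType_iff.1 hi x (relInt_subset_pointedCone hxR),
      fun i hi => ?_⟩
    rw [hxe, LinearMap.add_apply]
    exact add_pos_of_pos_of_nonneg (mul_pos hε (hpl.2 i hi)) (h.2 i)
  · obtain ⟨hxR, hxl⟩ := hx
    refine mem_relInt_pointedCone.2 ⟨⟨relInt_subset_pointedCone hxR,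
      openFacet_subset_closedChamber hxl⟩, fun y hy => ?_⟩
    have hev : ∀ᶠ ε in 𝓝[>] (0 : ℝ), x + ε • (-y) ∈ S.closedChamber :=
      eventually_add_smul_mem_closedChamber hxl fun i hi => by
        simp [mem_lowerType_iff.1 hi y hy.1]
    obtain ⟨ε, ⟨h1, h2⟩, hε⟩ := ((hev.and (eventually_sub_smul_mem hxR hy.1)).and
      self_mem_nhdsWithin).exists
    refine ⟨ε, hε, h2, ?_⟩
    rwa [smul_neg, ← sub_eq_add_neg] at h1

end Main

end ReflectionDatum

theorem mainTheorem4 {𝔥 : Type*} [AddCommGroup 𝔥] [Module ℝ 𝔥] [FiniteDimensional ℝ 𝔥] {n : ℕ}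
    (S : ReflectionDatum 𝔥 n) (hS : S.IsLinearCoxeterSystem)
    (Y : PointedCone ℝ (Module.Dual ℝ 𝔥)) (hY : S.IsInvariantSubcone Y)
    (R : PointedCone ℝ (Module.Dual ℝ 𝔥)) (hR : R ∈ S.crossSection Y) :
    (relInt (R : Set (Module.Dual ℝ 𝔥)) ∩ S.closedChamber =
      ⋃ J ∈ S.finiteIndices R,
        relInt (R : Set (Module.Dual ℝ 𝔥)) ∩ S.openFacet (S.lowerType R ∪ J)) ∧
    (S.finiteIndices R).PairwiseDisjoint
      (fun J => relInt (R : Set (Module.Dual ℝ 𝔥)) ∩ S.openFacet (S.lowerType R ∪ J)) ∧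
    ∀ J ∈ S.finiteIndices R,
      (relInt (R : Set (Module.Dual ℝ 𝔥)) ∩ S.openFacet (S.lowerType R ∪ J)).Nonempty ∧
      Finite (S.parabolic J) ∧
      S.mid J '' relInt ((R : Set (Module.Dual ℝ 𝔥)) ∩ S.closedChamber) =
        relInt (R : Set (Module.Dual ℝ 𝔥)) ∩ S.openFacet (S.lowerType R ∪ J) ∧
      S.mid J '' relInt ((R : Set (Module.Dual ℝ 𝔥)) ∩ S.closedFacet (S.lowerType R)) =
        relInt (R : Set (Module.Dual ℝ 𝔥)) ∩ S.openFacet (S.lowerType R ∪ J) := by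
  obtain ⟨hRY, p, hp, hpC⟩ := hR
  obtain ⟨J₀, hJ₀, hpJ₀⟩ := hS.exists_finiteIndices hY hRY hp hpC
  -- The given point of ri(R) ∩ C̄, lifted into F_{υ_*}. Its averages show that every stratum is
  -- nonempty.
  obtain ⟨x, -, hx⟩ := hS.exists_add_smul_rootComb hJ₀ hp hpJ₀
  refine ⟨Set.Subset.antisymm (fun l hl => ?_) ?_,
    ReflectionDatum.pairwiseDisjoint_inter_openFacet _, fun J hJ => ?_⟩
  · obtain ⟨J, hJ, hlJ⟩ := hS.exists_finiteIndices hY hRY hl.1 hl.2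
    exact Set.mem_biUnion hJ ⟨hl.1, hlJ⟩
  · exact Set.iUnion₂_subset fun J _ =>
      Set.inter_subset_inter_right _ ReflectionDatum.openFacet_subset_closedChamber
  · have hfin := hS.finite_parabolic (hS.isPositiveType_of_finitePart hJ.2)
    have himage := hS.mid_image hJ
    refine ⟨⟨_, hS.mid_mem hJ hx.1 hx.2⟩, hfin, ?_, ?_⟩
    · rw [ReflectionDatum.relInt_inter_closedChamber ⟨_, hx⟩, himage]
    · rw [ReflectionDatum.inter_closedFacet_lowerType,
        ReflectionDatum.relInt_inter_closedChamber ⟨_, hx⟩, himage]
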